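/- **Proposition (Chow trace of isotrivial families).** Let $\pi:\mathcal A\to X$ be a flat proper morphism of smooth complex projective varieties whose generic fibre $\mathcal A_\eta$ is an abelian variety over $K=\mathbb C(X)$, and let $\mathcal A$ be polarized by an ample line bundle $M$. Assume that $\pi$ is isotrivial: over the closed points of some non-empty open subset of $X$, any two fibres of $\pi$ are isomorphic as abelian varieties with the polarization induced by $M$. Let $\Delta\subset X$ be the set of points over which the fibre of $\pi$ is not smooth. Let $G$ be the holonomy group of $\pi$, that is: there are a complex abelian variety $A$ (the typical fibre of $\pi$), an irreducible unramified Galois covering $s:Y\to X-\Delta$ with group $G$, a faithful action of $G$ on $A$ by automorphisms of the abelian variety preserving the polarizations induced by $M$, and an isomorphism over $X-\Delta$ $$\pi^{-1}(X-\Delta)\;\cong\;(Y\times A)/G,\qquad g(y,a)=(gy,ga),$$ and no proper quotient group of $G$ admits such data. Fix such data for $G$. Let $A^G$ be the maximal abelian subvariety of $A$ fixed (pointwise) by $G$, i.e. an abelian subvariety fixed by $G$ that contains every other one. Then $A^G$ exists, the $\mathbb C$-trace of $\mathcal A_\eta$ exists, and it is isomorphic to $A^G$ as an abelian variety over $\mathbb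 C$. Here a $k$-trace of an abelian variety $V$ over an extension $K$ of a field $k$ is an abelian variety $B$ over $k$ together with a homomorphism $\tau:B\otimes_kK\to V$ over $K$ such that, for every extension $E/k$ linearly disjoint from $K$ over $k$, with compositum $KE$, every abelian variety $C$ over $E$ and every homomorphism $\alpha:C\otimes_EKE\to V\otimes_KKE$, there is a unique homomorphism $\alpha':C\to B\otimes_kE$ over $E$ with $\alpha=\tau\circ\alpha'$ after extension of scalars to $KE$. -/

import Mathlib

open CategoryTheory CategoryTheory.Limits AlgebraicGeometry MonoidalCategory
open CartesianMonoidalCategory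

noncomputable section

namespace IsotrivialTrace

/-! ### Group schemes over a field and base change -/

/-- Group schemes over the field `k`; morphisms are the homomorphisms of group schemes. -/
abbrev GroupScheme (k : Type) [Field k] : Type 1 := Grp (Over (Spec (CommRingCat.of k)))

/-- An abelian variety over `k`: a proper smooth geometrically integral group scheme. -/
structure IsAbelianVariety {k : Type} [Field k] (A : GroupScheme k) : Prop where
  isProper : IsProper A.X.hom
  smooth : Smooth A.X.hom
  geometricallyIntegral : GeometricallyIntegral A.X.hom

/-- The morphism `Spec K → Spec k` of a field extension `K / k`. -/
abbrev specMap (k K : Type) [Field k] [Field K] [Algebra k K] :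
    Spec (CommRingCat.of K) ⟶ Spec (CommRingCat.of k) :=
  Spec.map (CommRingCat.ofHom (algebraMap k K))

/-- Extension of scalars `A ↦ A ⊗ₖ K` for group schemes. -/
def baseChange (k K : Type) [Field k] [Field K] [Algebra k K] :
    GroupScheme k ⥤ GroupScheme K :=
  (Over.pullback (specMap k K)).mapGrp

lemma specMap_comp (k K L : Type) [Field k] [Field K] [Field L] [Algebra k K] [Algebra K L]
    [Algebra k L] [IsScalarTower k K L] : specMap k L = specMap K L ≫ specMap k K := by
  rw [specMap, specMap, specMap, ← Spec.map_comp, ← CommRingCat.ofHom_comp,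
    ← IsScalarTower.algebraMap_eq]

/-- The canonical isomorphism `A ⊗ₖ L ≅ (A ⊗ₖ K) ⊗_K L`. -/
def baseChangeTower (k K L : Type) [Field k] [Field K] [Field L] [Algebra k K] [Algebra K L]
    [Algebra k L] [IsScalarTower k K L] :
    baseChange k L ≅ baseChange k K ⋙ baseChange K L :=
  Functor.mapGrpNatIso
      (conjugateIsoEquiv (Over.mapPullbackAdj (specMap k L))
        ((Over.mapPullbackAdj (specMap K L)).comp (Over.mapPullbackAdj (specMap k K)))
        ((Over.mapCongr _ _ (specMap_comp k K L) ≪≫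
          Over.mapComp (specMap K L) (specMap k K)).symm)) ≪≫
    Functor.mapGrpCompIso

/-! ### The Chow trace -/

/-- `(B, τ)` is the `K/k`-trace of the abelian variety `A` over `K`: for every extension `E / k`
which is linearly disjoint from `K` over `k`, with compositum `L = KE`, every abelian variety `C`
over `E` and every homomorphism `α : C ⊗_E L → A ⊗_K L`, there is a unique homomorphism
`α' : C → B ⊗ₖ E` over `E` with `α = τ ∘ α'` after extension of scalars to `L`. -/
structure IsTrace (k K : Type) [Field k] [Field K] [Algebra k K] (A : GroupScheme K)
    (B : GroupScheme k) (τ : (baseChange k K).obj B ⟶ A) : Prop where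
  isAbelianVariety : IsAbelianVariety B
  existsUnique : ∀ (E L : Type) [Field E] [Field L] [Algebra k E] [Algebra k L] [Algebra E L]
    [Algebra K L] [IsScalarTower k E L] [IsScalarTower k K L],
    (IsScalarTower.toAlgHom k E L).fieldRange.LinearDisjoint
      (IsScalarTower.toAlgHom k K L).fieldRange →
    (IsScalarTower.toAlgHom k E L).fieldRange ⊔ (IsScalarTower.toAlgHom k K L).fieldRange = ⊤ →
    ∀ C : GroupScheme E, IsAbelianVariety C →
    ∀ α : (baseChange E L).obj C ⟶ (baseChange K L).obj A,
      ∃! α' : C ⟶ (baseChange k E).obj B,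
        α = (baseChange E L).map α' ≫ (baseChangeTower k E L).inv.app B ≫
          (baseChangeTower k K L).hom.app B ≫ (baseChange K L).map τ

/-! ### Line bundles, ampleness and polarizations -/

/-- The section `s` of `M` over `U` is a basis of `M` over `U`. -/
def IsGenerator {X : Scheme.{0}} (M : X.Modules) (U : X.Opens) (s : M.presheaf.obj (.op U)) :
    Prop :=
  ∀ (V : X.Opens) (h : V ≤ U),
    Function.Bijective fun r : Γ(X, V) => r • (M.presheaf.map (homOfLE h).op s)

/-- `M` is a line bundle (locally free of rank one). -/
def IsLineBundle {X : Scheme.{0}} (M : X.Modules) : Prop :=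
  ∀ x : X, ∃ U : X.Opens, x ∈ U ∧ ∃ s : M.presheaf.obj (.op U), IsGenerator M U s

/-- The tensor product of sheaves of modules: the sheaf associated with `U ↦ M(U) ⊗ N(U)`. -/
def tensor {X : Scheme.{0}} (M N : X.Modules) : X.Modules :=
  (PresheafOfModules.sheafification (𝟙 X.ringCatSheaf.obj)).obj
    (PresheafOfModules.Monoidal.tensorObj (R := X.presheaf) M.val N.val)

/-- `tensorPow M n` is the tensor power `M ^ (n + 1)`. -/
def tensorPow {X : Scheme.{0}} (M : X.Modules) : ℕ → X.Modules
  | 0 => M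
  | n + 1 => tensor (tensorPow M n) M

/-- The set of points at which the global section `s` of the line bundle `M` does not vanish. -/
def nonvanishing {X : Scheme.{0}} (M : X.Modules) (s : M.presheaf.obj (.op ⊤)) : Set X :=
  {x | ∃ (V : X.Opens), x ∈ V ∧ IsGenerator M V (M.presheaf.map (homOfLE le_top).op s)}

/-- The line bundle `M` on the quasi-compact scheme `X` is ample: the affine ones among the sets
`X_s`, for `s` a global section of a positive power of `M`, cover `X`. -/
structure IsAmple {X : Scheme.{0}} (M : X.Modules) : Prop where
  isLineBundle : IsLineBundle M
  compactSpace : CompactSpace X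
  exists_affine : ∀ x : X, ∃ (n : ℕ) (s : (tensorPow M n).presheaf.obj (.op ⊤)) (U : X.Opens),
    (U : Set X) = nonvanishing (tensorPow M n) s ∧ x ∈ U ∧ IsAffineOpen U

/-- The pullback of a sheaf of modules. -/
abbrev pull {X Y : Scheme.{0}} (f : X ⟶ Y) (M : Y.Modules) : X.Modules :=
  (Scheme.Modules.pullback f).obj M

/-- Translation of a complex group scheme by a complex point. -/
def translation (A : GroupScheme ℂ) (x : 𝟙_ (Over (Spec (CommRingCat.of ℂ))) ⟶ A.X) :
    A.X.left ⟶ A.X.left :=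
  (GrpObj.mulRight x).hom.left

/-- The line bundles `M` and `N` on the complex abelian variety `A` induce the same map
`φ_M = φ_N : A → Pic⁰(A)`, `φ_M(x) = t_x^* M ⊗ M⁻¹`; for ample `M` and `N` this says that they
define the same polarization. -/
def SamePolarization (A : GroupScheme ℂ) (M N : A.X.left.Modules) : Prop :=
  ∀ x : 𝟙_ (Over (Spec (CommRingCat.of ℂ))) ⟶ A.X,
    Nonempty (tensor (pull (translation A x) M) N ≅ tensor (pull (translation A x) N) M)

/-! ### Complex projective varieties and families of abelian varieties -/

attribute [local instance] MvPolynomial.gradedAlgebra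

/-- Complex projective space of dimension `n`. -/
def projectiveSpace (n : ℕ) : Over (Spec (CommRingCat.of ℂ)) :=
  Over.mk (Proj.toSpecZero (MvPolynomial.homogeneousSubmodule (Fin (n + 1)) ℂ) ≫
    Spec.map (CommRingCat.ofHom
      (algebraMap ℂ (MvPolynomial.homogeneousSubmodule (Fin (n + 1)) ℂ 0))))

/-- A smooth complex projective variety. -/
structure IsSmoothProjectiveVariety (X : Over (Spec (CommRingCat.of ℂ))) : Prop where
  isIntegral : IsIntegral X.left
  smooth : Smooth X.hom
  projective : ∃ (n : ℕ) (i : X ⟶ projectiveSpace n), IsClosedImmersion i.left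

/-- A smooth complex projective variety `𝒜` with a flat proper morphism `π` to a smooth complex
projective variety `X`. -/
structure IsFlatProperFamily {𝒜 X : Over (Spec (CommRingCat.of ℂ))} (π : 𝒜 ⟶ X) : Prop where
  total : IsSmoothProjectiveVariety 𝒜
  base : IsSmoothProjectiveVariety X
  flat : Flat π.left
  proper : IsProper π.left

variable {𝒜 X : Over (Spec (CommRingCat.of ℂ))}

/-- The generic point `Spec ℂ(X) → X`. -/
def genericPt (X : Over (Spec (CommRingCat.of ℂ))) [IsIntegral X.left] :
    Spec (CommRingCat.of X.left.functionField) ⟶ X.left :=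
  X.left.fromSpecStalk (genericPoint X.left)

/-- `ℂ(X)` is an extension of `ℂ`. -/
instance (X : Over (Spec (CommRingCat.of ℂ))) [IsIntegral X.left] :
    Algebra ℂ X.left.functionField :=
  (Spec.preimage (genericPt X ≫ X.hom)).hom.toAlgebra

/-- The generic fibre of `π`, a scheme over `ℂ(X)`. -/
def genericFibre (π : 𝒜 ⟶ X) [IsIntegral X.left] :
    Over (Spec (CommRingCat.of X.left.functionField)) :=
  (Over.pullback (genericPt X)).obj (Over.mk π.left)

/-- The complex points of a complex scheme. -/
abbrev ComplexPoint (X : Over (Spec (CommRingCat.of ℂ))) : Type :=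
  𝟙_ (Over (Spec (CommRingCat.of ℂ))) ⟶ X

/-- The family `π`, polarized by the ample line bundle `M` on `𝒜`, is isotrivial: over the points
of a nonempty open subset of `X` any two fibres are isomorphic as polarized abelian varieties,
that is, they can be identified with one complex abelian variety `B` in such a way that the
restrictions of `M` induce the same polarization of `B`. (The origins of the fibres play no role
here, as translations act trivially on polarizations.) -/
def IsIsotrivial (π : 𝒜 ⟶ X) (M : 𝒜.left.Modules) : Prop :=
  ∃ U : X.left.Opens, (U : Set X.left).Nonempty ∧
    ∀ x y : ComplexPoint X, Set.range x.left ⊆ U → Set.range y.left ⊆ U →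
      ∃ (B : GroupScheme ℂ) (_ : IsAbelianVariety B) (i j : B.X ⟶ 𝒜),
        IsPullback i (toUnit B.X) π x ∧ IsPullback j (toUnit B.X) π y ∧
          SamePolarization B (pull i.left M) (pull j.left M)

/-- The discriminant of `π`: the points of `X` over which the fibre is not smooth. -/
def discriminant (π : 𝒜 ⟶ X) : Set X.left :=
  {x | ¬ Smooth (π.left.fiberToSpecResidueField x)}

/-- An unramified Galois covering `s : Y → X - Δ` with Galois group `G`, where `G` is a group of
automorphisms of a polarized abelian variety `A`, and an identification of the part of `𝒜` over
`X - Δ` with the quotient of `Y × A` by the diagonal action of `G`. As `G` acts freely on `Y`, such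
an identification is a morphism `q : Y × A → 𝒜` invariant under the diagonal action for which
the square formed by `q`, the projection `Y × A → Y`, `π` and `s` is cartesian. -/
structure HolonomyDatum (π : 𝒜 ⟶ X) (M : 𝒜.left.Modules) (G : Type) [Group G] where
  /-- The fibre. -/
  A : GroupScheme ℂ
  isAbelianVariety : IsAbelianVariety A
  /-- The action of `G` on the fibre. -/
  act : G →* Aut A
  act_injective : Function.Injective act
  /-- The complement of the discriminant. -/
  U : X.left.Opens
  U_eq : (U : Set X.left) = (discriminant π)ᶜ
  /-- The total space of the covering of `X - Δ`. -/
  Y : Scheme.{0}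
  isIntegral : IsIntegral Y
  /-- The covering map. -/
  s : Y ⟶ U
  isFinite : IsFinite s
  etale : Etale s
  surjective : Surjective s
  /-- The action of `G` on `Y` over `X - Δ`. -/
  deck : G →* Aut (Over.mk s)
  /-- The covering is Galois with group `G`: the map `G × Y → Y ×_U Y`, `(g, y) ↦ (y, gy)`, is an
  isomorphism. -/
  galois : IsIso (Sigma.desc fun g : G =>
    pullback.lift (f := s) (g := s) (𝟙 Y) (deck g).hom.left
      ((Category.id_comp s).trans (Over.w (deck g).hom).symm))
  /-- The quotient map `Y × A → 𝒜`. -/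
  q : Over.mk (s ≫ U.ι ≫ X.hom) ⊗ A.X ⟶ 𝒜
  isPullback : IsPullback q.left (fst (Over.mk (s ≫ U.ι ≫ X.hom)) A.X).left π.left (s ≫ U.ι)
  invariant : ∀ g : G,
    (Over.homMk (U := Over.mk (s ≫ U.ι ≫ X.hom)) (V := Over.mk (s ≫ U.ι ≫ X.hom))
      (deck g).hom.left (Over.w_assoc (deck g).hom _) ⊗ₘ (act g).hom.hom.hom) ≫ q = q
  /-- The action of `G` on the fibre preserves the polarizations induced from `𝒜`. -/
  polarization : ∀ (g : G) (y : ComplexPoint (Over.mk (s ≫ U.ι ≫ X.hom))),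
    let i : A.X ⟶ 𝒜 := lift (toUnit A.X ≫ y) (𝟙 A.X) ≫ q
    SamePolarization A (pull (act g).hom.hom.hom.left (pull i.left M)) (pull i.left M)

/-- `G` is the holonomy group of `π`: a datum as above exists for `G`, and for no proper quotient
of `G`. -/
def IsHolonomyGroup (π : 𝒜 ⟶ X) (M : 𝒜.left.Modules) (G : Type) [Group G] : Prop :=
  Nonempty (HolonomyDatum π M G) ∧
    ∀ (N : Subgroup G) [N.Normal], Nonempty (HolonomyDatum π M (G ⧸ N)) → N = ⊥

/-! ### The fixed abelian subvariety -/

/-- `ι : B → A` is an abelian subvariety of `A` fixed by `G` (pointwise). -/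
structure IsFixedAbelianSubvariety {G : Type} [Group G] {A : GroupScheme ℂ} (act : G →* Aut A)
    {B : GroupScheme ℂ} (ι : B ⟶ A) : Prop where
  isAbelianVariety : IsAbelianVariety B
  isClosedImmersion : IsClosedImmersion ι.hom.hom.left
  fixed : ∀ g : G, ι ≫ (act g).hom = ι

/-- `ι : B → A` is `A^G`, the maximal abelian subvariety of `A` fixed by `G`. -/
structure IsMaximalFixedAbelianSubvariety {G : Type} [Group G] {A : GroupScheme ℂ}
    (act : G →* Aut A) {B : GroupScheme ℂ} (ι : B ⟶ A) : Prop extends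
    IsFixedAbelianSubvariety act ι where
  maximal : ∀ {B' : GroupScheme ℂ} (ι' : B' ⟶ A), IsFixedAbelianSubvariety act ι' →
    ∃ f : B' ⟶ B, f ≫ ι = ι'

end IsotrivialTrace

end

open IsotrivialTrace

/-!
Let `K` be the function field of `X` and `V` the generic fibre of `π`. Restricting the covering of
the holonomy datum to the generic point of `X` gives a connected torsor `P` over `Spec K` under `G`,
and the quotient map of the datum becomes a morphism `φ : P × A ⟶ V`, invariant under `G`, which
identifies `P × A` with `P × V` over `P`; after a translation, `φ (y, 0) = 0` (`Splitting`,
`HolonomyDatum.nonempty_splitting`).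

*The subvariety `A^G`.* The fixed points of `G` form a closed subset of `A`. An irreducible component
`Z` of this set through the origin contains every fixed integral scheme `T` that passes through the
origin, since the product `Z · T` is again irreducible and fixed. In particular `Z` is a subgroup,
and a maximal fixed abelian subvariety (`exists_isMaximalFixedAbelianSubvariety`,
`IsMaximalFixedAbelianSubvariety.exists_lift`).

*The trace.* On the points of `B = A^G` the value of `φ (y, b)` does not depend on `y`, so that `φ`
descends to a homomorphism `τ` from `B ⊗ K` to `V`. Let `E` be linearly disjoint from `K`, with
compositum `L`, let `C` be an abelian variety over `E` and `α` a homomorphism from `C ⊗ L` to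
`V ⊗ L`. Then `α (l, c) = φ (y, f (y, c))` for a unique morphism `f` from `P_L × C` to `A`, where
`P_L` is the base change of `P` to `L`. Linear disjointness enters through
`geometricallyIntegral_pullback_snd_comp`: as `ℂ` is algebraically closed, `P` is geometrically
integral over `ℂ`, and `P_L`, which is a localization of `P × E`, is geometrically integral over `E`.
The scheme `P_L × P_L × C`, with the first product formed over `E`, is therefore integral, and the
rigidity lemma, applied to `f (y₁, c) f (y₂, c)⁻¹`, shows that `f` does not depend on the point of
`P_L` (`map_lift_comp_eq`). Hence `f` descends to a morphism `β` from `C` to `A`. Comparing `f` at `y`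
and at `g y` shows that `β` is fixed by `G`, so that `β` factors through `B`; this gives the
homomorphism over `E` that is required (`Splitting.isTrace`).

Morphisms of schemes are descended along faithfully flat quasi-compact morphisms, which are effective
epimorphisms. A morphism from an abelian variety that respects the origins is a homomorphism, by
rigidity.
-/

/-! ### The rigidity lemma -/

namespace IsotrivialTrace

/-- A morphism from a reduced scheme factors through a closed immersion as soon as it does so on
the underlying sets. -/
lemma exists_lift_of_range_subset {T X Z : Scheme.{0}} [IsReduced T] (i : Z ⟶ X)
    [IsClosedImmersion i] (f : T ⟶ X) (h : Set.range f ⊆ Set.range i) :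
    ∃ l : T ⟶ Z, l ≫ i = f := by
  have : Surjective (pullback.snd i f) := ⟨by
    rw [← Set.range_eq_univ, Scheme.Pullback.range_snd, Set.eq_univ_iff_forall]
    exact fun x ↦ h ⟨x, rfl⟩⟩
  have := isIso_of_isClosedImmersion_of_surjective (pullback.snd i f)
  exact ⟨inv (pullback.snd i f) ≫ pullback.fst i f, by simp [pullback.condition]⟩

/-- A morphism from a proper integral scheme over an algebraically closed field to an affine
scheme is constant. -/
lemma comp_section_comp_of_isAffine {Ω : Type} [Field Ω] [IsAlgClosed Ω] {Z V : Scheme.{0}}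
    [IsIntegral Z] (p : Z ⟶ Spec (.of Ω)) [UniversallyClosed p] (r : Spec (.of Ω) ⟶ Z)
    (hr : r ≫ p = 𝟙 _) [IsAffine V] (g : Z ⟶ V) : p ≫ r ≫ g = g := by
  have hF := isField_of_universallyClosed Ω p
  let F := (Scheme.ΓSpecIso (.of Ω)).inv ≫ p.appTop
  have hint : F.hom.IsIntegral := by
    apply RingHom.isIntegral_respectsIso.2
      (e := (Scheme.ΓSpecIso _).symm.commRingCatIsoToRingEquiv)
    exact isIntegral_appTop_of_universallyClosed p
  have : IsIso F := by
    rw [ConcreteCategory.isIso_iff_bijective]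
    let := hF.toField
    exact IsAlgClosed.ringHom_bijective_of_isIntegral F.hom hint
  have : IsIso p.appTop := IsIso.of_isIso_comp_left (Scheme.ΓSpecIso (.of Ω)).inv _
  have h1 : p.appTop ≫ r.appTop = 𝟙 _ := by
    rw [← Scheme.Hom.comp_appTop, hr, Scheme.Hom.id_appTop]
  have h2 : r.appTop ≫ p.appTop = 𝟙 _ := by
    rw [← cancel_epi p.appTop, reassoc_of% h1, Category.comp_id]
  apply ext_of_isAffine
  rw [Scheme.Hom.comp_appTop, Scheme.Hom.comp_appTop, Category.assoc, h2, Category.comp_id]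

/-- The same holds for morphisms whose range lies in an affine open subset. -/
lemma comp_section_comp_of_range_subset {Ω : Type} [Field Ω] [IsAlgClosed Ω] {Z V : Scheme.{0}}
    [IsIntegral Z] (p : Z ⟶ Spec (.of Ω)) [UniversallyClosed p] (r : Spec (.of Ω) ⟶ Z)
    (hr : r ≫ p = 𝟙 _) (U : V.Opens) (hU : IsAffineOpen U) (g : Z ⟶ V)
    (hg : Set.range g ⊆ U) : p ≫ r ≫ g = g := by
  have : IsAffine U := hU
  let g' : Z ⟶ U := IsOpenImmersion.lift U.ι g (by simpa using hg)
  have : g' ≫ U.ι = g := IsOpenImmersion.lift_fac _ _ _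
  rw [← this, ← Category.assoc, ← Category.assoc, Category.assoc p,
    comp_section_comp_of_isAffine p r hr g']

lemma exists_geometricPoint {W : Scheme.{0}} (x : W) :
    ∃ (Ω : Type) (_ : Field Ω) (_ : IsAlgClosed Ω) (w : Spec (.of Ω) ⟶ W), ∀ y, w y = x := by
  refine ⟨AlgebraicClosure (W.residueField x), inferInstance, inferInstance,
    Spec.map (CommRingCat.ofHom (algebraMap (W.residueField x) _)) ≫ W.fromSpecResidueField x, fun y ↦ ?_⟩
  rw [Scheme.Hom.comp_apply, Scheme.fromSpecResidueField_apply]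

/-- A family of morphisms from proper geometrically integral schemes to an affine scheme is
constant on geometric fibres. -/
lemma pullback_fst_comp_section_comp {T W V : Scheme.{0}} (q : T ⟶ W) [UniversallyClosed q]
    [GeometricallyIntegral q] (σ : W ⟶ T) (hσ : σ ≫ q = 𝟙 W) (h : T ⟶ V) {Ω : Type} [Field Ω]
    [IsAlgClosed Ω] (w : Spec (.of Ω) ⟶ W) (U : V.Opens) (hU : IsAffineOpen U)
    (hwU : ∀ x y, q x = w y → h x ∈ U) :
    pullback.fst q w ≫ q ≫ σ ≫ h = pullback.fst q w ≫ h := by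
  have : IsIntegral (pullback q w) :=
    GeometricallyIntegral.geometrically_isIntegral (f := q) _ _ _ (.of_hasPullback q w)
  have hw : (w ≫ σ) ≫ q = 𝟙 _ ≫ w := by simp [hσ]
  have key := comp_section_comp_of_range_subset (pullback.snd q w)
    (pullback.lift (w ≫ σ) (𝟙 _) hw) (pullback.lift_snd _ _ _) U hU (pullback.fst q w ≫ h) (by
      rintro _ ⟨y, rfl⟩
      exact hwU (pullback.fst q w y) (pullback.snd q w y) (by
        rw [← Scheme.Hom.comp_apply, ← Scheme.Hom.comp_apply, pullback.condition]))
  rw [← key, pullback.lift_fst_assoc, pullback.condition_assoc, Category.assoc]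

/-- **Rigidity lemma.** Let `q : T ⟶ W` be proper with geometrically integral fibres and a section
`σ`. A morphism from `T` to a separated scheme that contracts one fibre of `q` to a point factors
through `q`. -/
lemma rigidity {T W V : Scheme.{0}} [IsIntegral T] [V.IsSeparated] (q : T ⟶ W) [IsProper q]
    [GeometricallyIntegral q] (σ : W ⟶ T) (hσ : σ ≫ q = 𝟙 W) (h : T ⟶ V) (w₀ : W) (v : V)
    (hv : ∀ x : T, q x = w₀ → h x = v) : q ≫ σ ≫ h = h := by
  obtain ⟨_, ⟨U, hU, rfl⟩, hvU, -⟩ :=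
    V.isBasis_affineOpens.exists_subset_of_mem_open (Set.mem_univ v) isOpen_univ
  -- The fibres over the open set `O` are mapped into the affine open set `U`.
  let O : Set W := (q '' (h ⁻¹' (U : Set V)ᶜ))ᶜ
  have hO : IsOpen O :=
    (q.isClosedMap _ (U.isOpen.isClosed_compl.preimage h.continuous)).isOpen_compl
  have hw₀ : w₀ ∈ O := by
    rintro ⟨x, hx, rfl⟩
    exact hx ((hv x rfl).symm ▸ hvU)
  have hne : (q ⁻¹' O).Nonempty := ⟨_, (by
    change q (σ w₀) ∈ O
    rwa [← Scheme.Hom.comp_apply, hσ] : σ w₀ ∈ q ⁻¹' O)⟩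
  have hd : Dense (q ⁻¹' O) := (hO.preimage q.continuous).dense hne
  have : IsDominant (equalizer.ι (q ≫ σ ≫ h) h) := by
    refine ⟨hd.mono fun x hx ↦ ?_⟩
    obtain ⟨Ω, _, _, w, hw⟩ := exists_geometricPoint (q x)
    obtain ⟨y, hy, -⟩ := Scheme.Pullback.exists_preimage_pullback (f := q) (g := w) x
      (IsLocalRing.closedPoint Ω) (hw _).symm
    refine ⟨equalizer.lift (pullback.fst q w)
      (pullback_fst_comp_section_comp q σ hσ h w U hU fun x' y' hx' ↦ ?_) y, ?_⟩
    · by_contra hy'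
      have hx'' : q x ∈ O := hx
      rw [← hw y', ← hx'] at hx''
      exact hx'' ⟨x', hy', rfl⟩
    · rw [← Scheme.Hom.comp_apply, equalizer.lift_ι, hy]
  exact ext_of_isDominant (equalizer.ι (q ≫ σ ≫ h) h) (equalizer.condition _ _)

open scoped MonObj

lemma isSeparated_left {k : Type} [Field k] (V : Over (Spec (CommRingCat.of k)))
    [IsSeparated V.hom] : V.left.IsSeparated := by
  rw [Scheme.isSeparated_iff, show terminal.from V.left = V.hom ≫ terminal.from _ from
    terminal.hom_ext _ _]
  infer_instance

lemma one_comp_of_η_comp {C : Type*} [Category* C] [CartesianMonoidalCategory C] {M N Z : C}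
    [MonObj M] [MonObj N] (f : M ⟶ N) (hf : η[M] ≫ f = η[N]) : (1 : Z ⟶ M) ≫ f = 1 := by
  rw [Hom.one_def, Category.assoc, hf, Hom.one_def]

/-- The rigidity lemma in the category of schemes over `S`. -/
lemma rigidity_over {S : Scheme.{0}} {T W V S₀ : Over S} [IsIntegral T.left] [V.left.IsSeparated]
    (q : T ⟶ W) [IsProper q.left] [GeometricallyIntegral q.left] (σ : W ⟶ T) (hσ : σ ≫ q = 𝟙 W)
    (h : T ⟶ V) [Nonempty S₀.left] (w : S₀ ⟶ W) (v : S₀ ⟶ V)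
    (hv : ∀ (Z : Over S) (a : Z ⟶ T) (b : Z ⟶ S₀), a ≫ q = b ≫ w → a ≫ h = b ≫ v) :
    q ≫ σ ≫ h = h := by
  obtain ⟨s⟩ := ‹Nonempty S₀.left›
  ext1
  refine rigidity q.left σ.left congr($(hσ).left) h.left (w.left s) (v.left s) fun x hx ↦ ?_
  obtain ⟨z, rfl, rfl⟩ := Scheme.Pullback.exists_preimage_pullback x s hx
  have := congr($(hv (Over.mk (pullback.fst q.left w.left ≫ T.hom))
    (Over.homMk (pullback.fst q.left w.left))
    (Over.homMk (pullback.snd q.left w.left) (by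
      have h1 := Over.w q
      have h2 := Over.w w
      simp only [Over.mk_hom]
      rw [← h1, ← h2, pullback.condition_assoc]))
    (by ext1; exact pullback.condition)).left z)
  simpa using this

/-- A morphism from an abelian variety to a separated group scheme that preserves the origins is
a homomorphism. -/
lemma isMonHom_of_one_comp {k : Type} [Field k] {C V : GroupScheme k} (hC : IsAbelianVariety C)
    [IsSeparated V.X.hom] (f : C.X ⟶ V.X) (hf : η[C.X] ≫ f = η[V.X]) : IsMonHom f := by
  have := hC.isProper
  have := hC.smooth
  have := hC.geometricallyIntegral
  have := isSeparated_left V.X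
  have : IsIntegral C.X.left := GeometricallyIntegral.isIntegral_of_subsingleton C.X.hom
  have : IsLocallyNoetherian C.X.left := LocallyOfFiniteType.isLocallyNoetherian C.X.hom
  have : IsIntegral (C.X ⊗ C.X).left := by dsimp; infer_instance
  have : IsProper (fst C.X C.X).left := by dsimp; infer_instance
  have : GeometricallyIntegral (fst C.X C.X).left := by dsimp; infer_instance
  refine ⟨hf, ?_⟩
  let h : C.X ⊗ C.X ⟶ V.X := (μ[C.X] ≫ f) * ((fst _ _ ≫ f) * (snd _ _ ≫ f))⁻¹
  have h1 (Z : Over (Spec (CommRingCat.of k))) (a b : Z ⟶ C.X) :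
      lift a b ≫ h = ((a * b) ≫ f) * ((a ≫ f) * (b ≫ f))⁻¹ := by
    simp [h, MonObj.comp_mul, GrpObj.comp_inv, Hom.mul_def a b]
  have h2 (Z : Over (Spec (CommRingCat.of k))) : (1 : Z ⟶ C.X) ≫ f = 1 :=
    one_comp_of_η_comp f hf
  have : Nonempty (𝟙_ (Over (Spec (CommRingCat.of k)))).left :=
    inferInstanceAs (Nonempty (Spec (CommRingCat.of k)))
  have key := rigidity_over (fst C.X C.X) (lift (𝟙 _) 1) (by simp) h η[C.X] η[V.X]
    fun Z a b hab ↦ by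
      have : a = lift 1 (a ≫ snd _ _) := by
        ext1
        · rw [hab, Hom.one_def, lift_fst, toUnit_unique b]
        · simp
      rw [this, h1, h2, one_mul, one_mul, mul_inv_cancel, Hom.one_def, toUnit_unique b]
  rw [h1, h2, mul_one, mul_one, mul_inv_cancel, MonObj.comp_one] at key
  have hf' : μ[C.X] ≫ f = (fst _ _ ≫ f) * (snd _ _ ≫ f) := mul_inv_eq_one.mp key.symm
  rw [hf', Hom.mul_def]
  congr 1
/-! ### Tensor products of domains -/

section TensorProduct

open TensorProduct

lemma eq_zero_or_eq_zero_of_mul_eq_zero_of_finiteType {k A B : Type*} [Field k] [IsAlgClosed k]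
    [CommRing A] [IsDomain A] [Algebra k A] [Algebra.FiniteType k A] [CommRing B] [IsDomain B]
    [Algebra k B] {x y : A ⊗[k] B} (h : x * y = 0) : x = 0 ∨ y = 0 := by
  let b := Module.Basis.ofVectorSpace k B
  let e := Algebra.TensorProduct.basis A b
  have : IsJacobsonRing A := isJacobsonRing_of_finiteType (A := k)
  -- At every `k`-point `φ` of `A` the images of `x` and `y` in the domain `B` multiply to zero.
  have hφ (φ : A →ₐ[k] k) (i j) : φ (e.repr x i * e.repr y j) = 0 := by
    let Φ : A ⊗[k] B →ₐ[k] B :=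
      Algebra.TensorProduct.lift ((Algebra.ofId k B).comp φ) (AlgHom.id k B) fun _ _ ↦ .all _ _
    have hΦ (z : A ⊗[k] B) (i) : b.repr (Φ z) i = φ (e.repr z i) := by
      induction z with
      | zero => simp
      | add z w hz hw => simp [hz, hw]
      | tmul a c =>
        simp [Φ, e, Algebra.ofId_apply, ← Algebra.smul_def]
    have hxy : Φ x * Φ y = 0 := by rw [← map_mul, h, map_zero]
    rw [map_mul, ← hΦ, ← hΦ]
    obtain h | h := mul_eq_zero.mp hxy <;> simp [h]
  have h0 (i j) : e.repr x i * e.repr y j = 0 := by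
    rw [← Ideal.mem_bot, ← IsJacobsonRing.out ‹_› (Ideal.isRadical_iff_quotient_reduced _ |>.mpr
      (inferInstance : IsReduced (A ⧸ (⊥ : Ideal A)))), Ideal.jacobson, Ideal.mem_sInf]
    rintro m ⟨-, hm⟩
    let := Ideal.Quotient.field m
    have := finite_of_finite_type_of_isJacobsonRing k (A ⧸ m)
    let ψ : k ≃ₐ[k] A ⧸ m := AlgEquiv.ofBijective (Algebra.ofId k _)
      IsAlgClosed.algebraMap_bijective_of_isIntegral
    have := hφ ((ψ.symm : (A ⧸ m) →ₐ[k] k).comp (Ideal.Quotient.mkₐ k m)) i j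
    rw [← Ideal.Quotient.eq_zero_iff_mem]
    simpa using this
  by_contra! hxy
  obtain ⟨i, hi⟩ : ∃ i, e.repr x i ≠ 0 := by
    by_contra! H
    exact hxy.1 (e.repr.map_eq_zero_iff.mp (Finsupp.ext H))
  obtain ⟨j, hj⟩ : ∃ i, e.repr y i ≠ 0 := by
    by_contra! H
    exact hxy.2 (e.repr.map_eq_zero_iff.mp (Finsupp.ext H))
  exact mul_ne_zero hi hj (h0 i j)

/-- The tensor product of two domains over an algebraically closed field is a domain. -/
lemma isDomain_tensorProduct_of_isAlgClosed (k A B : Type*) [Field k] [IsAlgClosed k]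
    [CommRing A] [IsDomain A] [Algebra k A] [CommRing B] [IsDomain B] [Algebra k B] :
    IsDomain (A ⊗[k] B) := by
  have : NoZeroDivisors (A ⊗[k] B) := by
    refine ⟨fun {x y} h ↦ ?_⟩
    obtain ⟨C, hC, hx⟩ := exists_fg_and_mem_baseChange x
    obtain ⟨D, hD, hy⟩ := exists_fg_and_mem_baseChange y
    let F := C ⊔ D
    have : Algebra.FiniteType k F := F.fg_iff_finiteType.mp (hC.sup hD)
    have hinj : Function.Injective (Algebra.TensorProduct.map (AlgHom.id A A) F.val) :=
      Module.Flat.lTensor_preserves_injective_linearMap (M := A) F.val.toLinearMap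
        Subtype.val_injective
    have hle (E : Subalgebra k B) (hE : E ≤ F) {z} (hz : z ∈ E.baseChange A) :
        ∃ w, Algebra.TensorProduct.map (AlgHom.id A A) F.val w = z := by
      obtain ⟨w, rfl⟩ := hz
      refine ⟨Algebra.TensorProduct.map (AlgHom.id A A) (Subalgebra.inclusion hE) w, ?_⟩
      induction w with
      | zero => simp
      | add u v hu hv => simp_all
      | tmul a c => simp
    obtain ⟨x, rfl⟩ := hle C le_sup_left hx
    obtain ⟨y, rfl⟩ := hle D le_sup_right hy
    rw [← map_mul, map_eq_zero_iff _ hinj] at h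
    let s := Algebra.TensorProduct.comm k A F
    have := eq_zero_or_eq_zero_of_mul_eq_zero_of_finiteType (x := s x) (y := s y)
      (by rw [← map_mul, h, map_zero])
    exact this.imp (fun h ↦ by rw [(map_eq_zero_iff s s.injective).mp h, map_zero])
      (fun h ↦ by rw [(map_eq_zero_iff s s.injective).mp h, map_zero])
  exact NoZeroDivisors.to_isDomain _
end TensorProduct

/-! ### Geometrically integral schemes -/

lemma geometricallyIntegral_of_isIntegral_pullback {k : Type} [Field k] {X : Scheme.{0}}
    (f : X ⟶ Spec (.of k))
    (H : ∀ (L : Type) [Field L] [Algebra k L], IsIntegral (pullback f (specMap k L))) :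
    GeometricallyIntegral f := by
  refine ⟨geometrically_iff_of_commRing.mpr fun L _ _ Y a b h ↦ ?_⟩
  let : Algebra k L := inferInstanceAs (Algebra (CommRingCat.of k) L)
  have := H L
  let e : Y ≅ pullback f (specMap k L) := h.isoPullback
  have : Nonempty Y := .map e.inv inferInstance
  exact isIntegral_of_isOpenImmersion e.hom

lemma geometricallyIntegral_specMap (k K : Type) [Field k] [IsAlgClosed k] [Field K]
    [Algebra k K] : GeometricallyIntegral (specMap k K) := by
  refine geometricallyIntegral_of_isIntegral_pullback _ fun L _ _ ↦ ?_
  have := isDomain_tensorProduct_of_isAlgClosed k K L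
  let e : pullback (specMap k K) (specMap k L) ≅ _ := pullbackSpecIso k K L
  have : Nonempty ↥(Limits.pullback (specMap k K) (specMap k L)) := inferInstance
  exact isIntegral_of_isOpenImmersion e.hom

/-- An integral locally noetherian scheme over an algebraically closed field is geometrically
integral. -/
lemma geometricallyIntegral_of_isAlgClosed {k : Type} [Field k] [IsAlgClosed k] {X : Scheme.{0}}
    (f : X ⟶ Spec (.of k)) [IsIntegral X] [IsLocallyNoetherian X] : GeometricallyIntegral f := by
  refine geometricallyIntegral_of_isIntegral_pullback _ fun L _ _ ↦ ?_
  have := geometricallyIntegral_specMap k L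
  infer_instance

/-- The morphisms all of whose base changes to affine integral schemes have an integral or empty
source. -/
def preservesIntegral : MorphismProperty Scheme.{0} :=
  MorphismProperty.universally fun X Y _ ↦ IsAffine Y → IsIntegral Y → Nonempty X → IsIntegral X

/-- A nonempty base change of a localization is a localization of a domain at nonzero elements. -/
lemma preservesIntegral_specMap_of_isLocalization {R S : Type} [CommRing R] [CommRing S]
    [Algebra R S] (M : Submonoid R) [IsLocalization M S] :
    preservesIntegral (Spec.map (CommRingCat.ofHom (algebraMap R S))) := by
  intro X' Y' i₁ i₂ f' h _ _ _
  let D := Γ(Y', ⊤)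
  let ψ : CommRingCat.of R ⟶ D := Spec.preimage (Y'.isoSpec.inv ≫ i₂)
  let _ : Algebra R D := ψ.hom.toAlgebra
  have hi : i₂ = Y'.isoSpec.hom ≫ Spec.map ψ := by simp [ψ]
  have h' : IsPullback (f' ≫ Y'.isoSpec.hom) i₁ (Spec.map (CommRingCat.ofHom (algebraMap R D)))
      (Spec.map (CommRingCat.ofHom (algebraMap R S))) :=
    h.of_iso (Iso.refl _) Y'.isoSpec (Iso.refl _) (Iso.refl _) (by simp) (by simp)
      (by rw [Iso.refl_hom, Category.comp_id]; exact hi) (by simp)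
  let e : X' ≅ Spec (.of (TensorProduct R D S)) := h'.isoPullback ≪≫ pullbackSpecIso R D S
  have : IsLocalization (Algebra.algebraMapSubmonoid D M) (TensorProduct R D S) := inferInstance
  have : Nontrivial (TensorProduct R D S) := by
    have : Nonempty (Spec (.of (TensorProduct R D S))) := .map e.hom ‹_›
    exact PrimeSpectrum.nonempty_iff_nontrivial.mp this
  have : IsDomain (TensorProduct R D S) := by
    refine IsLocalization.isDomain_of_le_nonZeroDivisors _
      (M := Algebra.algebraMapSubmonoid D M) (le_nonZeroDivisors_of_noZeroDivisors fun h0 ↦ ?_)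
    exact not_subsingleton _ (IsLocalization.subsingleton (M := Algebra.algebraMapSubmonoid D M)
      (S := TensorProduct R D S) h0)
  exact isIntegral_of_isOpenImmersion e.hom

attribute [local simp] pullback.lift_fst pullback.lift_snd pullback.lift_fst_assoc
  pullback.lift_snd_assoc

lemma preservesIntegral_lift_of_ringHom {k E K L : Type} [Field k] [Field E] [Field K]
    [Field L] [Algebra k E] [Algebra k K] [Algebra E L] [Algebra K L]
    (φ : TensorProduct k E K →+* L)
    (h1 : φ.comp Algebra.TensorProduct.includeLeftRingHom = algebraMap E L)
    (h2 : φ.comp (Algebra.TensorProduct.includeRight : K →ₐ[k] _).toRingHom = algebraMap K L)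
    (w : specMap E L ≫ specMap k E = specMap K L ≫ specMap k K)
    (h : preservesIntegral (Spec.map (CommRingCat.ofHom φ))) :
    preservesIntegral (pullback.lift (f := specMap k E) (g := specMap k K)
      (specMap E L) (specMap K L) w) := by
  have : preservesIntegral.RespectsIso := MorphismProperty.universally_respectsIso _
  rw [← MorphismProperty.cancel_right_of_respectsIso preservesIntegral _
    (pullbackSpecIso k E K).inv] at h
  convert h
  refine pullback.hom_ext ?_ ?_
  · refine (pullback.lift_fst _ _ _).trans ?_
    rw [Category.assoc, pullbackSpecIso_inv_fst, ← Spec.map_comp, ← CommRingCat.ofHom_comp, h1]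
  · refine (pullback.lift_snd _ _ _).trans ?_
    rw [Category.assoc, pullbackSpecIso_inv_snd, ← Spec.map_comp, ← CommRingCat.ofHom_comp]
    exact congr(Spec.map (CommRingCat.ofHom $(h2.symm)))

/-- The compositum of two linearly disjoint extensions `E` and `K` of `k` is the fraction field of
`E ⊗ₖ K`; hence it is a localization. -/
lemma preservesIntegral_lift_of_linearDisjoint {k E K L : Type} [Field k] [Field E] [Field K]
    [Field L] [Algebra k E] [Algebra k K] [Algebra k L] [Algebra E L] [Algebra K L]
    [IsScalarTower k E L] [IsScalarTower k K L]
    (hd : (IsScalarTower.toAlgHom k E L).fieldRange.LinearDisjoint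
      (IsScalarTower.toAlgHom k K L).fieldRange)
    (hs : (IsScalarTower.toAlgHom k E L).fieldRange ⊔ (IsScalarTower.toAlgHom k K L).fieldRange = ⊤)
    (w : specMap E L ≫ specMap k E = specMap K L ≫ specMap k K) :
    preservesIntegral (pullback.lift (f := specMap k E) (g := specMap k K)
      (specMap E L) (specMap K L) w) := by
  let fE := IsScalarTower.toAlgHom k E L
  let fK := IsScalarTower.toAlgHom k K L
  let φ : TensorProduct k E K →ₐ[k] L := Algebra.TensorProduct.productMap fE fK
  have hinj : Function.Injective φ := by
    simp_rw [IntermediateField.linearDisjoint_iff', AlgHom.fieldRange_toSubalgebra,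
      Subalgebra.linearDisjoint_iff_injective] at hd
    have hφ : φ = (fE.range.mulMap fK.range).comp (Algebra.TensorProduct.congr
        (AlgEquiv.ofInjective fE fE.injective) (AlgEquiv.ofInjective fK fK.injective)) := by
      ext <;> simp [φ, fE, fK]
    simpa only [hφ, AlgHom.coe_comp, AlgEquiv.coe_toAlgHom, EquivLike.injective_comp] using hd
  let : Algebra (TensorProduct k E K) L := φ.toRingHom.toAlgebra
  have : FaithfulSMul (TensorProduct k E K) L :=
    (faithfulSMul_iff_algebraMap_injective _ _).mpr hinj
  have hsurj (z : L) : ∃ x y, φ x / φ y = z := by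
    have hz : z ∈ IntermediateField.adjoin k (fE.range ∪ fK.range : Set L) := by
      have hle : fE.fieldRange ⊔ fK.fieldRange ≤
          IntermediateField.adjoin k (fE.range ∪ fK.range : Set L) :=
        sup_le (fun x hx ↦ IntermediateField.subset_adjoin _ _ (.inl hx))
          (fun x hx ↦ IntermediateField.subset_adjoin _ _ (.inr hx))
      exact hle (hs ▸ IntermediateField.mem_top)
    have hr : Algebra.adjoin k (fE.range ∪ fK.range : Set L) ≤ φ.range := by
      rw [Algebra.adjoin_le_iff, Set.union_subset_iff]
      constructor
      · rintro _ ⟨x, rfl⟩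
        exact ⟨x ⊗ₜ 1, by simp [φ]⟩
      · rintro _ ⟨x, rfl⟩
        exact ⟨1 ⊗ₜ x, by simp [φ]⟩
    obtain ⟨r, hr', s, hs', rfl⟩ := IntermediateField.mem_adjoin_iff_div.mp hz
    obtain ⟨x, rfl⟩ := hr hr'
    obtain ⟨y, rfl⟩ := hr hs'
    exact ⟨x, y, rfl⟩
  have : IsFractionRing (TensorProduct k E K) L := .of_field _ _ fun z ↦ by
    obtain ⟨x, y, h⟩ := hsurj z
    exact ⟨x, y, h.symm⟩
  have h := preservesIntegral_specMap_of_isLocalization (S := L)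
    (nonZeroDivisors (TensorProduct k E K))
  have h1 : (algebraMap (TensorProduct k E K) L).comp Algebra.TensorProduct.includeLeftRingHom =
      algebraMap E L := by
    ext x
    change φ (x ⊗ₜ 1) = _
    simp [φ, fE]
  have h2 : (algebraMap (TensorProduct k E K) L).comp
      (Algebra.TensorProduct.includeRight : K →ₐ[k] _).toRingHom = algebraMap K L := by
    ext x
    change φ (1 ⊗ₜ x) = _
    simp [φ, fK]
  exact preservesIntegral_lift_of_ringHom _ h1 h2 w h

/-- In terms of fields: `P_L ×_E E'` is the base change of `P ×_k E'`, which lies over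
`Spec (E ⊗ₖ K)`, along the morphism `Spec L ⟶ Spec (E ⊗ₖ K)`. -/
lemma isPullback_pullback_comp {C : Type*} [Category* C] [HasPullbacks C]
    {S SE SK SL SE' P : C} {e : SE ⟶ S} {κ : SK ⟶ S} {lE : SL ⟶ SE} {lK : SL ⟶ SK} {e' : SE' ⟶ SE}
    (w : lE ≫ e = lK ≫ κ) (p : P ⟶ SK) :
    IsPullback
      (pullback.lift (pullback.fst (pullback.snd p lK ≫ lE) e' ≫ pullback.fst p lK)
        (pullback.snd _ _) (by
          rw [← pullback.condition_assoc]
          simp only [Category.assoc]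
          rw [w, pullback.condition_assoc]) :
        pullback (pullback.snd p lK ≫ lE) e' ⟶ pullback (p ≫ κ) (e' ≫ e))
      (pullback.fst _ _ ≫ pullback.snd _ _)
      (pullback.lift (pullback.snd _ _ ≫ e') (pullback.fst _ _ ≫ p) (by
        rw [Category.assoc, Category.assoc, ← pullback.condition]) :
        pullback (p ≫ κ) (e' ≫ e) ⟶ pullback e κ)
      (pullback.lift lE lK w) := by
  refine ⟨⟨?_⟩, ⟨PullbackCone.IsLimit.mk _
    (fun s ↦ pullback.lift (pullback.lift (s.fst ≫ pullback.fst _ _) s.snd ?_)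
      (s.fst ≫ pullback.snd _ _) ?_) ?_ ?_ ?_⟩⟩
  · ext1
    · simpa using pullback.condition.symm
    · simp [pullback.condition]
  · have := s.condition =≫ pullback.snd _ _
    simpa using this
  · have := s.condition =≫ pullback.fst _ _
    simpa using this.symm
  · intro s
    ext1 <;> simp
  · intro s
    simp
  · intro s m h1 h2
    ext1
    · ext1
      · simpa using h1 =≫ pullback.fst _ _
      · simpa using h2
    · simpa using h1 =≫ pullback.snd _ _

/-- If `P` is a geometrically integral affine scheme over `k` with a morphism to `Spec K`, then its
base change to the compositum `L` of `K` with a linearly disjoint extension `E` of `k` is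
geometrically integral over `E`. -/
lemma geometricallyIntegral_pullback_snd_comp {k E K L : Type} [Field k] [Field E] [Field K]
    [Field L] [Algebra k E] [Algebra k K] [Algebra k L] [Algebra E L] [Algebra K L]
    [IsScalarTower k E L] [IsScalarTower k K L]
    (hd : (IsScalarTower.toAlgHom k E L).fieldRange.LinearDisjoint
      (IsScalarTower.toAlgHom k K L).fieldRange)
    (hs : (IsScalarTower.toAlgHom k E L).fieldRange ⊔ (IsScalarTower.toAlgHom k K L).fieldRange = ⊤)
    {P : Scheme.{0}} [IsAffine P] (p : P ⟶ Spec (.of K))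
    [GeometricallyIntegral (p ≫ specMap k K)] :
    GeometricallyIntegral (pullback.snd p (specMap K L) ≫ specMap E L) := by
  refine geometricallyIntegral_of_isIntegral_pullback _ fun E' _ _ ↦ ?_
  let : Algebra k E' := ((algebraMap E E').comp (algebraMap k E)).toAlgebra
  have : IsScalarTower k E E' := .of_algebraMap_eq fun _ ↦ rfl
  have w : specMap E L ≫ specMap k E = specMap K L ≫ specMap k K := by
    rw [← specMap_comp, ← specMap_comp]
  have hP : Nonempty P := by
    have : Surjective (p ≫ specMap k K) := inferInstance
    obtain ⟨x, -⟩ := (p ≫ specMap k K).surjective (Classical.arbitrary (Spec (.of k)))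
    exact ⟨x⟩
  have hY : IsIntegral (pullback (p ≫ specMap k K) (specMap E E' ≫ specMap k E)) := by
    rw [← specMap_comp]
    exact GeometricallyIntegral.geometrically_isIntegral (f := p ≫ specMap k K) _ _ _
      (.of_hasPullback _ (specMap k E'))
  exact preservesIntegral_lift_of_linearDisjoint hd hs w _ _ _
    (isPullback_pullback_comp w p) inferInstance hY inferInstance

end IsotrivialTrace

/-! ### The maximal fixed abelian subvariety -/

namespace IsotrivialTrace

open scoped MonObj

/-- A subobject of a group object that contains the identity and is closed under products and
inverses is a group object. -/
@[reducible] noncomputable def grpObjOfMono {C : Type*} [Category* C] [CartesianMonoidalCategory C]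
    {Z A : C} [GrpObj A] (i : Z ⟶ A) [Mono i] (o : 𝟙_ C ⟶ Z) (ho : o ≫ i = η[A])
    (m : Z ⊗ Z ⟶ Z) (hm : m ≫ i = (fst Z Z ≫ i) * (snd Z Z ≫ i))
    (ν : Z ⟶ Z) (hν : ν ≫ i = i⁻¹) : GrpObj Z where
  one := o
  mul := m
  inv := ν
  one_mul := by
    rw [← cancel_mono i, Category.assoc, hm, MonObj.comp_mul, whiskerRight_fst_assoc,
      whiskerRight_snd_assoc, ho, toUnit_unique (fst (𝟙_ C) Z) (toUnit _),
      ← Hom.one_def, one_mul, leftUnitor_hom]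
  mul_one := by
    rw [← cancel_mono i, Category.assoc, hm, MonObj.comp_mul, whiskerLeft_fst_assoc,
      whiskerLeft_snd_assoc, ho, toUnit_unique (snd Z (𝟙_ C)) (toUnit _),
      ← Hom.one_def, mul_one, rightUnitor_hom]
  mul_assoc := by
    rw [← cancel_mono i, Category.assoc, Category.assoc, Category.assoc, hm]
    simp [MonObj.comp_mul, hm, mul_assoc]
  left_inv := by
    rw [← cancel_mono i, Category.assoc, hm, MonObj.comp_mul, lift_fst_assoc, lift_snd_assoc, hν,
      Category.id_comp, inv_mul_cancel, Category.assoc, ho, Hom.one_def]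
  right_inv := by
    rw [← cancel_mono i, Category.assoc, hm, MonObj.comp_mul, lift_fst_assoc, lift_snd_assoc, hν,
      Category.id_comp, mul_inv_cancel, Category.assoc, ho, Hom.one_def]

variable {G : Type} [Group G] {A : GroupScheme ℂ}

/-- The morphism `f : T ⟶ A` is fixed by the action of `G` on `A`. -/
def IsFixed (act : G →* Aut A) {T : Over (Spec (CommRingCat.of ℂ))} (f : T ⟶ A.X) : Prop :=
  ∀ g, f ≫ (act g).hom.hom.hom = f

variable {act : G →* Aut A}

lemma IsFixed.comp {T T' : Over (Spec (CommRingCat.of ℂ))} {f : T ⟶ A.X} (hf : IsFixed act f)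
    (j : T' ⟶ T) : IsFixed act (j ≫ f) := fun g ↦ by rw [Category.assoc, hf g]

lemma IsFixed.mul {T : Over (Spec (CommRingCat.of ℂ))} {a b : T ⟶ A.X} (ha : IsFixed act a)
    (hb : IsFixed act b) : IsFixed act (a * b) := fun g ↦ by
  rw [MonObj.mul_comp, ha g, hb g]

lemma IsFixed.inv {T : Over (Spec (CommRingCat.of ℂ))} {a : T ⟶ A.X} (ha : IsFixed act a) :
    IsFixed act a⁻¹ := fun g ↦ by
  rw [GrpObj.inv_comp, ha g]

lemma isFixed_of_isDominant [IsSeparated A.X.hom] {T T' : Over (Spec (CommRingCat.of ℂ))}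
    {f : T ⟶ A.X} (j : T' ⟶ T) [IsDominant j.left] [IsReduced T.left]
    (hf : IsFixed act (j ≫ f)) : IsFixed act f := fun g ↦ by
  ext1
  refine ext_of_isDominant_of_isSeparated A.X.hom ?_ j.left ?_
  · rw [Over.w, Over.w]
  · simpa using congr($(hf g).left)

/-- The scheme-theoretic image of a fixed integral scheme is a fixed integral closed subscheme. -/
lemma IsFixed.exists_image [IsSeparated A.X.hom] {T : Over (Spec (CommRingCat.of ℂ))}
    [IsIntegral T.left] {f : T ⟶ A.X} [QuasiCompact f.left] (hf : IsFixed act f) :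
    ∃ (Z : Over (Spec (CommRingCat.of ℂ))) (i : Z ⟶ A.X), IsIntegral Z.left ∧
      IsClosedImmersion i.left ∧ IsFixed act i ∧ Set.range i.left = closure (Set.range f.left) := by
  let Z : Over (Spec (CommRingCat.of ℂ)) := Over.mk (f.left.imageι ≫ A.X.hom)
  let i : Z ⟶ A.X := Over.homMk f.left.imageι
  let j : T ⟶ Z := Over.homMk f.left.toImage
  have hj : j ≫ i = f := by ext1; simp [i, j]
  have : IsClosedImmersion i.left := inferInstanceAs (IsClosedImmersion f.left.imageι)
  have : IsDominant j.left := inferInstanceAs (IsDominant f.left.toImage)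
  have : QuasiCompact j.left := inferInstanceAs (QuasiCompact f.left.toImage)
  have : IsReduced Z.left := by
    have h := (TopCat.Presheaf.app_injective_iff_stalkFunctor_map_injective
      (F := f.left.image.sheaf) f.left.toImage.c).mp fun x ↦ f.left.stalkFunctor_toImage_injective x
    refine ⟨fun U ↦ ?_⟩
    have hU : Function.Injective (f.left.toImage.app U) := h U
    exact isReduced_of_injective (f.left.toImage.app U).hom hU
  have : IrreducibleSpace Z.left := by
    rw [irreducibleSpace_def, Set.top_eq_univ, ← j.left.denseRange.closure_range,
      isIrreducible_iff_closure, ← Set.image_univ]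
    exact (IrreducibleSpace.isIrreducible_univ _).image _ j.left.continuous.continuousOn
  refine ⟨Z, i, isIntegral_of_irreducibleSpace_of_isReduced _, inferInstance,
    isFixed_of_isDominant j (hj ▸ hf), ?_⟩
  change Set.range f.left.imageι = _
  rw [Scheme.IdealSheafData.range_subschemeι, Scheme.Hom.support_ker]

/-- The closed set of the fixed points of `G`. -/
noncomputable def fixedSet (act : G →* Aut A) : Set A.X.left :=
  ⋂ g, Set.range (equalizer.ι (𝟙 A.X) (act g).hom.hom.hom).left

lemma isClosed_fixedSet [IsSeparated A.X.hom] : IsClosed (fixedSet act) :=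
  isClosed_iInter fun g ↦
    (equalizer.ι (𝟙 A.X) (act g).hom.hom.hom).left.isClosedEmbedding.isClosed_range

lemma isFixed_iff_range_subset [IsSeparated A.X.hom] {T : Over (Spec (CommRingCat.of ℂ))}
    [IsReduced T.left] {f : T ⟶ A.X} : IsFixed act f ↔ Set.range f.left ⊆ fixedSet act := by
  refine ⟨fun hf ↦ Set.subset_iInter fun g ↦ ?_, fun hf g ↦ ?_⟩
  · have h : f ≫ 𝟙 A.X = f ≫ (act g).hom.hom.hom := by rw [Category.comp_id, hf g]
    rintro _ ⟨t, rfl⟩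
    refine ⟨(equalizer.lift f h).left t, ?_⟩
    rw [← Scheme.Hom.comp_apply, ← Over.comp_left, equalizer.lift_ι]
  · obtain ⟨l, hl⟩ := exists_lift_of_range_subset (equalizer.ι (𝟙 A.X) (act g).hom.hom.hom).left
      f.left (hf.trans (Set.iInter_subset _ g))
    have h := congr($(equalizer.condition (𝟙 A.X) (act g).hom.hom.hom).left)
    ext1
    rw [Over.comp_left, ← hl, Category.assoc, ← Over.comp_left, ← equalizer.condition,
      Category.comp_id]

variable (A) in
/-- The origin of `A`. -/
noncomputable def origin : A.X.left := η[A.X].left (IsLocalRing.closedPoint ℂ)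

lemma one_apply {T : Over (Spec (CommRingCat.of ℂ))} (t : T.left) :
    (1 : T ⟶ A.X).left t = origin A := by
  rw [Hom.one_def, Over.comp_left, Scheme.Hom.comp_apply, origin]
  congr 1
  exact Subsingleton.elim (α := PrimeSpectrum ℂ) _ _

lemma isFixed_one {T : Over (Spec (CommRingCat.of ℂ))} : IsFixed act (1 : T ⟶ A.X) := fun g ↦ by
  simp

lemma origin_mem_fixedSet [IsSeparated A.X.hom] : origin A ∈ fixedSet act := by
  have : IsReduced (𝟙_ (Over (Spec (CommRingCat.of ℂ)))).left :=
    inferInstanceAs (IsReduced (Spec (CommRingCat.of ℂ)))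
  exact isFixed_iff_range_subset.mp (isFixed_one (T := 𝟙_ _))
    ⟨(IsLocalRing.closedPoint ℂ), one_apply _⟩

/-- A maximal fixed integral closed subscheme through the origin. -/
lemma exists_maximal_isFixed (act : G →* Aut A) [IsSeparated A.X.hom] :
    ∃ (Z : Over (Spec (CommRingCat.of ℂ))) (i : Z ⟶ A.X), IsIntegral Z.left ∧
      IsClosedImmersion i.left ∧ IsFixed act i ∧ origin A ∈ Set.range i.left ∧
      ∀ (T : Over (Spec (CommRingCat.of ℂ))) [IsIntegral T.left] (f : T ⟶ A.X), IsFixed act f →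
        Set.range i.left ⊆ closure (Set.range f.left) →
        closure (Set.range f.left) ⊆ Set.range i.left := by
  have hF := isClosed_fixedSet (act := act)
  let C := irreducibleComponent (⟨origin A, origin_mem_fixedSet⟩ : fixedSet act)
  have hC : IsIrreducible (Subtype.val '' C) :=
    isIrreducible_irreducibleComponent.image _ continuous_subtype_val.continuousOn
  have hC' : IsClosed (Subtype.val '' C) :=
    hF.isClosedEmbedding_subtypeVal.isClosedMap _ isClosed_irreducibleComponent
  let ζ := hC.genericPoint
  have hζ : closure {ζ} = Subtype.val '' C := hC.closure_genericPoint hC'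
  let T : Over (Spec (CommRingCat.of ℂ)) := Over.mk (A.X.left.fromSpecResidueField ζ ≫ A.X.hom)
  let f : T ⟶ A.X := Over.homMk (A.X.left.fromSpecResidueField ζ)
  have : IsIntegral T.left := inferInstanceAs (IsIntegral (Spec (A.X.left.residueField ζ)))
  have : QuasiCompact f.left :=
    inferInstanceAs (QuasiCompact (A.X.left.fromSpecResidueField ζ))
  have hfr : Set.range f.left = {ζ} := A.X.left.range_fromSpecResidueField ζ
  have hf : IsFixed act f := by
    rw [isFixed_iff_range_subset, hfr, Set.singleton_subset_iff]
    obtain ⟨x, -, hx⟩ : ζ ∈ Subtype.val '' C := hζ ▸ subset_closure rfl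
    exact hx ▸ x.2
  obtain ⟨Z, i, hZ, hi, hfix, hr⟩ := hf.exists_image
  rw [hfr, hζ] at hr
  refine ⟨Z, i, hZ, hi, hfix, hr ▸ ⟨_, mem_irreducibleComponent, rfl⟩, fun T _ f hf h ↦ ?_⟩
  rw [hr] at h ⊢
  let f' : T.left → fixedSet act := fun t ↦ ⟨f.left t, isFixed_iff_range_subset.mp hf ⟨t, rfl⟩⟩
  have hf' : Continuous f' := f.left.continuous.subtype_mk _
  have hcl : Subtype.val '' closure (Set.range f') = closure (Set.range f.left) := by
    rw [← hF.isClosedEmbedding_subtypeVal.closure_image_eq, ← Set.range_comp]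
    rfl
  have hirr : IsIrreducible (closure (Set.range f')) := by
    rw [isIrreducible_iff_closure, ← Set.image_univ]
    exact (IrreducibleSpace.isIrreducible_univ _).image _ hf'.continuousOn
  rw [← hcl] at h ⊢
  exact (congrArg _ (eq_irreducibleComponent hirr.2
    ((Set.image_subset_image_iff Subtype.val_injective).mp h))).le

/-- A maximal fixed integral closed subscheme `Z` through the origin contains every fixed integral
scheme `T` through the origin: with the closure `W` of the image of `T`, the image of
`Z × W → A`, `(z, w) ↦ zw`, is again fixed, and contains both `Z` and `W`. -/
lemma exists_isFixed_and_factors (act : G →* Aut A) [IsProper A.X.hom] :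
    ∃ (Z : Over (Spec (CommRingCat.of ℂ))) (i : Z ⟶ A.X), IsIntegral Z.left ∧
      IsClosedImmersion i.left ∧ IsFixed act i ∧ (∃ o : 𝟙_ _ ⟶ Z, o ≫ i = η[A.X]) ∧
      ∀ (T S₀ : Over (Spec (CommRingCat.of ℂ))) [IsIntegral T.left] [Nonempty S₀.left]
        (f : T ⟶ A.X) [QuasiCompact f.left] (x : S₀ ⟶ T), IsFixed act f → x ≫ f = 1 →
        ∃ l : T ⟶ Z, l ≫ i = f := by
  have lift_of_range {W T : Over (Spec (CommRingCat.of ℂ))} (j : W ⟶ A.X) (f : T ⟶ A.X)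
      [IsReduced T.left] [IsClosedImmersion j.left]
      (h : Set.range f.left ⊆ Set.range j.left) : ∃ l : T ⟶ W, l ≫ j = f := by
    obtain ⟨l, hl⟩ := exists_lift_of_range_subset j.left f.left h
    exact ⟨Over.homMk l (by rw [← Over.w j, reassoc_of% hl, Over.w]), by ext1; exact hl⟩
  have lift_η {W : Over (Spec (CommRingCat.of ℂ))} (j : W ⟶ A.X) [IsClosedImmersion j.left]
      (h : origin A ∈ Set.range j.left) : ∃ o : 𝟙_ _ ⟶ W, o ≫ j = η[A.X] := by
    have : IsReduced (𝟙_ (Over (Spec (CommRingCat.of ℂ)))).left :=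
      inferInstanceAs (IsReduced (Spec (CommRingCat.of ℂ)))
    refine lift_of_range j η[A.X] ?_
    rintro _ ⟨t, rfl⟩
    rwa [MonObj.one_eq_one, one_apply]
  obtain ⟨Z, i, hZ, hi, hfix, ho, hmax⟩ := exists_maximal_isFixed act
  refine ⟨Z, i, hZ, hi, hfix, lift_η i ho, fun T S₀ _ _ f _ x hf hx ↦ lift_of_range i f ?_⟩
  obtain ⟨W, j, hW, hj, hjfix, hjr⟩ := hf.exists_image
  have hfj : Set.range f.left ⊆ Set.range j.left := hjr ▸ subset_closure
  obtain ⟨w, hw⟩ := lift_η j <| by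
    obtain ⟨s⟩ := ‹Nonempty S₀.left›
    refine hfj ⟨x.left s, ?_⟩
    rw [← Scheme.Hom.comp_apply, ← Over.comp_left, hx, one_apply]
  obtain ⟨z, hz⟩ := lift_η i ho
  have hint : IsIntegral (Z ⊗ W).left := by
    have : LocallyOfFiniteType Z.hom := by rw [← Over.w i]; infer_instance
    have : LocallyOfFiniteType W.hom := by rw [← Over.w j]; infer_instance
    have : IsLocallyNoetherian Z.left := LocallyOfFiniteType.isLocallyNoetherian Z.hom
    have : IsLocallyNoetherian W.left := LocallyOfFiniteType.isLocallyNoetherian W.hom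
    have := geometricallyIntegral_of_isAlgClosed W.hom
    dsimp
    infer_instance
  let h : Z ⊗ W ⟶ A.X := (fst Z W ≫ i) * (snd Z W ≫ j)
  have hzh : lift (𝟙 Z) (toUnit Z ≫ w) ≫ h = i := by
    rw [MonObj.comp_mul, lift_fst_assoc, lift_snd_assoc, Category.assoc, hw, Category.id_comp,
      ← Hom.one_def, mul_one]
  have hwh : lift (toUnit W ≫ z) (𝟙 W) ≫ h = j := by
    rw [MonObj.comp_mul, lift_fst_assoc, lift_snd_assoc, Category.assoc, hz, Category.id_comp,
      ← Hom.one_def, one_mul]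
  have hih : Set.range i.left ⊆ Set.range h.left := by
    rw [← hzh, Over.comp_left, Scheme.Hom.comp_base, TopCat.coe_comp]
    exact Set.range_comp_subset_range _ _
  have hjh : Set.range j.left ⊆ Set.range h.left := by
    rw [← hwh, Over.comp_left, Scheme.Hom.comp_base, TopCat.coe_comp]
    exact Set.range_comp_subset_range _ _
  exact hfj.trans <| hjh.trans <| subset_closure.trans <|
    hmax _ h ((hfix.comp _).mul (hjfix.comp _)) (hih.trans subset_closure)

/-- The maximal fixed integral closed subscheme through the origin is a fixed abelian subvariety. -/
lemma exists_isFixedAbelianSubvariety (act : G →* Aut A) (hA : IsAbelianVariety A) :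
    ∃ (B : GroupScheme ℂ) (j : B ⟶ A), IsFixedAbelianSubvariety act j ∧
      ∀ (T S₀ : Over (Spec (CommRingCat.of ℂ))) [IsIntegral T.left] [Nonempty S₀.left]
        (f : T ⟶ A.X) [QuasiCompact f.left] (x : S₀ ⟶ T), IsFixed act f → x ≫ f = 1 →
        ∃ l : T ⟶ B.X, l ≫ j.hom.hom = f := by
  have := hA.isProper
  have := isSeparated_left A.X
  obtain ⟨Z, i, hZ, hi, hfix, ⟨o, ho⟩, hfac⟩ := exists_isFixed_and_factors act
  have : Mono i := (Over.forget _).mono_of_mono_map (inferInstanceAs (Mono i.left))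
  have hprop : IsProper Z.hom := by rw [← Over.w i]; infer_instance
  have : IsLocallyNoetherian Z.left := LocallyOfFiniteType.isLocallyNoetherian Z.hom
  have hgeom := geometricallyIntegral_of_isAlgClosed Z.hom
  have hint : IsIntegral (Z ⊗ Z).left := by dsimp; infer_instance
  have : Nonempty (𝟙_ (Over (Spec (CommRingCat.of ℂ)))).left :=
    ⟨IsLocalRing.closedPoint ℂ⟩
  have hqc : CompactSpace (Z ⊗ Z).left := by
    have : QuasiCompact (Z ⊗ Z).hom := by dsimp; infer_instance
    exact QuasiCompact.compactSpace_of_compactSpace (Z ⊗ Z).hom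
  obtain ⟨m, hm⟩ := hfac (Z ⊗ Z) (𝟙_ _) ((fst Z Z ≫ i) * (snd Z Z ≫ i)) (lift o o)
    ((hfix.comp _).mul (hfix.comp _)) (by
      rw [MonObj.comp_mul, lift_fst_assoc, lift_snd_assoc, ho, MonObj.one_eq_one, mul_one])
  have hqc' : CompactSpace Z.left := QuasiCompact.compactSpace_of_compactSpace Z.hom
  obtain ⟨ν, hν⟩ := hfac Z (𝟙_ _) i⁻¹ o hfix.inv (by
    rw [GrpObj.comp_inv, ho, MonObj.one_eq_one, inv_one])
  let : GrpObj Z := grpObjOfMono i o ho m hm ν hν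
  have : IsMonHom i :=
    { one_hom := ho
      mul_hom := by
        rw [show μ[Z] ≫ i = _ from hm, Hom.mul_def]
        congr 1 }
  let B : GroupScheme ℂ := Grp.mk Z
  let j : B ⟶ A := Grp.homMk i
  have hsm : Smooth Z.hom := by
    let : GrpObj (Over.mk Z.hom) := inferInstanceAs (GrpObj Z)
    exact smooth_of_grpObj Z.hom
  exact ⟨B, j, ⟨⟨hprop, hsm, hgeom⟩, hi, fun g ↦ by ext1; exact hfix g⟩, hfac⟩

lemma IsFixedAbelianSubvariety.isFixed {B : GroupScheme ℂ} {j : B ⟶ A}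
    (h : IsFixedAbelianSubvariety act j) : IsFixed act j.hom.hom := fun g ↦
  congr($(h.fixed g).hom.hom)

lemma exists_isMaximalFixedAbelianSubvariety (act : G →* Aut A) (hA : IsAbelianVariety A) :
    ∃ (B : GroupScheme ℂ) (j : B ⟶ A), IsMaximalFixedAbelianSubvariety act j := by
  obtain ⟨B, j, hj, hfac⟩ := exists_isFixedAbelianSubvariety act hA
  have := hj.isClosedImmersion
  have : Mono j.hom.hom := (Over.forget _).mono_of_mono_map (inferInstanceAs (Mono j.hom.hom.left))
  refine ⟨B, j, { hj with maximal := fun {B'} j' hj' ↦ ?_ }⟩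
  have := hj'.isClosedImmersion
  have := hj'.isAbelianVariety.geometricallyIntegral
  have := hj'.isAbelianVariety.smooth
  have : IsIntegral B'.X.left := GeometricallyIntegral.isIntegral_of_subsingleton B'.X.hom
  have : Nonempty (𝟙_ (Over (Spec (CommRingCat.of ℂ)))).left :=
    ⟨IsLocalRing.closedPoint ℂ⟩
  obtain ⟨l, hl⟩ := hfac B'.X (𝟙_ _) j'.hom.hom η hj'.isFixed (by
    rw [IsMonHom.one_hom, MonObj.one_eq_one])
  have : IsMonHom l :=
    { one_hom := by rw [← cancel_mono j.hom.hom, Category.assoc, hl, IsMonHom.one_hom,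
        IsMonHom.one_hom]
      mul_hom := by rw [← cancel_mono j.hom.hom, Category.assoc, hl, IsMonHom.mul_hom,
        Category.assoc, IsMonHom.mul_hom, ← hl, tensorHom_comp_tensorHom_assoc] }
  exact ⟨Grp.homMk l, by ext1; exact hl⟩

/-- The maximal fixed abelian subvariety contains every fixed integral scheme through the
origin. -/
lemma IsMaximalFixedAbelianSubvariety.exists_lift (hA : IsAbelianVariety A) {B : GroupScheme ℂ}
    {j : B ⟶ A} (hj : IsMaximalFixedAbelianSubvariety act j)
    {T S₀ : Over (Spec (CommRingCat.of ℂ))} [IsIntegral T.left] [Nonempty S₀.left]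
    (f : T ⟶ A.X) [QuasiCompact f.left] (x : S₀ ⟶ T) (hf : IsFixed act f) (hx : x ≫ f = 1) :
    ∃ l : T ⟶ B.X, l ≫ j.hom.hom = f := by
  obtain ⟨B', j', hj', hfac⟩ := exists_isFixedAbelianSubvariety act hA
  obtain ⟨r, rfl⟩ := hj.maximal j' hj'
  obtain ⟨l, hl⟩ := hfac T S₀ f x hf hx
  exact ⟨l ≫ r.hom.hom, by simpa using hl⟩

end IsotrivialTrace

/-! ### Base change -/

namespace IsotrivialTrace

open scoped MonObj

section BaseChange

variable {k K : Type} [Field k] [Field K] [Algebra k K]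

variable (k K) in
/-- The projection `A ⊗ₖ K → A`. -/
noncomputable def baseChangeFst (A : GroupScheme k) : ((baseChange k K).obj A).X.left ⟶ A.X.left :=
  pullback.fst A.X.hom (specMap k K)

lemma baseChangeFst_condition (A : GroupScheme k) :
    baseChangeFst k K A ≫ A.X.hom = ((baseChange k K).obj A).X.hom ≫ specMap k K :=
  pullback.condition

lemma hom_ext_baseChange {A : GroupScheme k} {X : Over (Spec (CommRingCat.of K))}
    {u v : X ⟶ ((baseChange k K).obj A).X}
    (h : u.left ≫ baseChangeFst k K A = v.left ≫ baseChangeFst k K A) : u = v := by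
  ext1
  exact pullback.hom_ext h ((Over.w u).trans (Over.w v).symm)

lemma exists_lift_baseChange {A : GroupScheme k} {X : Over (Spec (CommRingCat.of K))}
    (u : X.left ⟶ A.X.left) (hu : u ≫ A.X.hom = X.hom ≫ specMap k K) :
    ∃ v : X ⟶ ((baseChange k K).obj A).X, v.left ≫ baseChangeFst k K A = u :=
  ⟨Over.homMk (pullback.lift u X.hom hu) (pullback.lift_snd _ _ _), pullback.lift_fst _ _ _⟩

lemma baseChange_map_left {A B : GroupScheme k} (f : A ⟶ B) :
    ((baseChange k K).map f).hom.hom.left ≫ baseChangeFst k K B =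
      baseChangeFst k K A ≫ f.hom.hom.left :=
  pullback.lift_fst _ _ _

lemma one_baseChange (A : GroupScheme k) (X : Over (Spec (CommRingCat.of K))) :
    (1 : X ⟶ ((baseChange k K).obj A).X).left ≫ baseChangeFst k K A =
      X.hom ≫ specMap k K ≫ η[A.X].left := by
  let l : X ⟶ (Over.pullback (specMap k K)).obj (𝟙_ _) :=
    Over.homMk (pullback.lift (X.hom ≫ specMap k K) X.hom (Category.comp_id _))
      (pullback.lift_snd _ _ _)
  let : GrpObj ((Over.pullback (specMap k K)).obj A.X) := ((baseChange k K).obj A).grp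
  have h : l ≫ (Over.pullback (specMap k K)).map (1 : 𝟙_ _ ⟶ A.X) =
      (1 : X ⟶ ((baseChange k K).obj A).X) := by
    refine Eq.trans ?_ (MonObj.comp_one l)
    congr 1
    exact Functor.map_one (Over.pullback (specMap k K))
  have hl : l.left ≫ pullback.fst _ _ = X.hom ≫ specMap k K := pullback.lift_fst _ _ _
  rw [← h, ← MonObj.one_eq_one, ← reassoc_of% hl]
  exact (Category.assoc _ _ _).trans (l.left ≫= pullback.lift_fst _ _ _)

lemma mapGrpNatIso_trans_mapGrpCompIso_hom_app {C D E : Type*} [Category* C] [Category* D]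
    [Category* E] [CartesianMonoidalCategory C] [CartesianMonoidalCategory D]
    [CartesianMonoidalCategory E] {F : C ⥤ E} {H : C ⥤ D} {H' : D ⥤ E} [F.Monoidal] [H.Monoidal]
    [H'.Monoidal] (θ : F ≅ H ⋙ H') (A : Grp C) :
    ((Functor.mapGrpNatIso θ ≪≫ Functor.mapGrpCompIso).hom.app A).hom.hom = θ.hom.app A.X := by
  simp
  exact Category.comp_id _

/-- The morphism `baseChangeTower` is compatible with the projections. -/
lemma baseChangeTower_hom_app (k K L : Type) [Field k] [Field K] [Algebra k K] [Field L] [Algebra K L] [Algebra k L]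
    [IsScalarTower k K L] (A : GroupScheme k) :
    ((baseChangeTower k K L).hom.app A).hom.hom.left ≫ baseChangeFst K L _ ≫ baseChangeFst k K A =
      baseChangeFst k L A := by
  let adj := (Over.mapPullbackAdj (specMap K L)).comp (Over.mapPullbackAdj (specMap k K))
  let e := Over.mapCongr _ _ (specMap_comp k K L) ≪≫ Over.mapComp (specMap K L) (specMap k K)
  have h := congr($(conjugateEquiv_counit (Over.mapPullbackAdj (specMap k L)) adj e.inv A.X).left)
  have h1 {X Y : Scheme.{0}} (f : X ⟶ Y) (Z : Over Y) :
      ((Over.mapPullbackAdj f).counit.app Z).left = pullback.fst Z.hom f := by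
    simp
  have h2 : (adj.counit.app A.X).left =
      pullback.fst ((Over.pullback (specMap k K)).obj A.X).hom (specMap K L) ≫
        pullback.fst A.X.hom (specMap k K) := by
    simp [adj, Adjunction.comp_counit_app]
  have h3 : (e.inv.app ((Over.pullback (specMap k L)).obj A.X)).left = 𝟙 _ := by
    simp [e]
  rw [Over.comp_left, Over.comp_left, h2, h3, h1] at h
  refine Eq.trans ?_ (h.trans (Category.id_comp _))
  exact congr(Over.Hom.left $(mapGrpNatIso_trans_mapGrpCompIso_hom_app
    (conjugateIsoEquiv (Over.mapPullbackAdj (specMap k L)) adj e.symm) A) ≫ _)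

/-- The equation in the definition of a trace, without the group schemes over the compositum. -/
lemma eq_baseChange_map_comp_iff {E L : Type} [Field E] [Field L] [Algebra k E] [Algebra k L]
    [Algebra E L] [Algebra K L] [IsScalarTower k E L] [IsScalarTower k K L] {V : GroupScheme K}
    {B : GroupScheme k} (τ : (baseChange k K).obj B ⟶ V) {C : GroupScheme E}
    (α : (baseChange E L).obj C ⟶ (baseChange K L).obj V) (α' : C ⟶ (baseChange k E).obj B)
    (z : ((baseChange E L).obj C).X.left ⟶ ((baseChange k K).obj B).X.left)
    (hz : z ≫ baseChangeFst k K B = baseChangeFst E L C ≫ α'.hom.hom.left ≫ baseChangeFst k E B)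
    (hz' : z ≫ ((baseChange k K).obj B).X.hom = ((baseChange E L).obj C).X.hom ≫ specMap K L) :
    α = (baseChange E L).map α' ≫ (baseChangeTower k E L).inv.app B ≫
          (baseChangeTower k K L).hom.app B ≫ (baseChange K L).map τ ↔
      α.hom.hom.left ≫ baseChangeFst K L V = z ≫ τ.hom.hom.left := by
  let w : (baseChange E L).obj C ⟶ (baseChange K L).obj ((baseChange k K).obj B) :=
    (baseChange E L).map α' ≫ (baseChangeTower k E L).inv.app B ≫ (baseChangeTower k K L).hom.app B
  have hinv : ((baseChangeTower k E L).inv.app B).hom.hom.left ≫ baseChangeFst k L B =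
      baseChangeFst E L _ ≫ baseChangeFst k E B := by
    have h : ((baseChangeTower k E L).inv.app B).hom.hom.left ≫
        ((baseChangeTower k E L).hom.app B).hom.hom.left = 𝟙 _ :=
      congr($((baseChangeTower k E L).inv_hom_id_app B).hom.hom.left)
    rw [← baseChangeTower_hom_app k E L B, reassoc_of% h]
  have hw : w.hom.hom.left ≫ baseChangeFst K L _ = z := by
    refine pullback.hom_ext ?_ ?_
    · refine Eq.trans ?_ hz.symm
      change ((_ ≫ _ ≫ _) ≫ baseChangeFst K L _) ≫ baseChangeFst k K B = _
      simp only [Category.assoc]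
      rw [baseChangeTower_hom_app, hinv, reassoc_of% baseChange_map_left (K := L) α']
    · refine Eq.trans ?_ hz'.symm
      have hc := w.hom.hom.left ≫= baseChangeFst_condition (K := L) ((baseChange k K).obj B)
      rw [Over.w_assoc] at hc
      exact (Category.assoc _ _ _).trans hc
  have key : α = w ≫ (baseChange K L).map τ ↔
      α.hom.hom.left ≫ baseChangeFst K L V = z ≫ τ.hom.hom.left := by
    have h : z ≫ τ.hom.hom.left =
        (w ≫ (baseChange K L).map τ).hom.hom.left ≫ baseChangeFst K L V := by
      rw [← hw]
      refine (Category.assoc _ _ _).trans ?_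
      rw [← baseChange_map_left]
      exact (Category.assoc _ _ _).symm
    rw [h]
    exact ⟨fun h ↦ by rw [h], fun h ↦ by ext1; exact hom_ext_baseChange h⟩
  simpa only [w, Category.assoc] using key

end BaseChange

/-- Descent of morphisms along a faithfully flat quasi-compact morphism. -/
lemma exists_desc {S : Scheme.{0}} {X Y Z : Over S} (p : X ⟶ Y) [Flat p.left] [Surjective p.left]
    [QuasiCompact p.left] (e : X ⟶ Z)
    (he : ∀ (T : Over S) (a b : T ⟶ X), a ≫ p = b ≫ p → a ≫ e = b ≫ e) :
    ∃ d : Y ⟶ Z, p ≫ d = e := by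
  have : EffectiveEpi p.left := inferInstance
  have h {T : Scheme.{0}} (a b : T ⟶ X.left) (hab : a ≫ p.left = b ≫ p.left) :
      a ≫ e.left = b ≫ e.left := by
    have hX : b ≫ X.hom = a ≫ X.hom := by rw [← Over.w p, reassoc_of% hab]
    let a' : Over.mk (a ≫ X.hom) ⟶ X := Over.homMk a
    let b' : Over.mk (a ≫ X.hom) ⟶ X := Over.homMk b hX
    exact congr($(he _ a' b' (by ext1; exact hab)).left)
  let d := EffectiveEpi.desc p.left e.left h
  have hd : p.left ≫ d = e.left := EffectiveEpi.fac p.left e.left h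
  refine ⟨Over.homMk d ?_, by ext1; exact hd⟩
  rw [← cancel_epi p.left, reassoc_of% hd, Over.w, Over.w]

/-- A morphism `f` from `Q × C` to `A`, where `C` is an abelian variety, does not depend on the point
of `Q` if it vanishes on `Q × 0`. The morphism `(y₁, y₂, c) ↦ f (y₁, c) f (y₂, c)⁻¹` on `Q × Q × C`
contracts `C` over each point of the diagonal, so that the rigidity lemma shows that it does not
depend on `c`. -/
lemma map_lift_comp_eq {k E : Type} [Field k] [Field E] [Algebra k E] {C : GroupScheme E}
    (hC : IsAbelianVariety C) {Q : Over (Spec (CommRingCat.of E))} [GeometricallyIntegral Q.hom]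
    [IsLocallyNoetherian Q.left] {A : GroupScheme k} [IsSeparated A.X.hom]
    (f : (Over.map (specMap k E)).obj (Q ⊗ C.X) ⟶ A.X)
    (hf : (Over.map (specMap k E)).map (lift (𝟙 Q) 1) ≫ f = 1)
    {T : Over (Spec (CommRingCat.of E))} (y₁ y₂ : T ⟶ Q) (c : T ⟶ C.X) :
    (Over.map (specMap k E)).map (lift y₁ c) ≫ f =
      (Over.map (specMap k E)).map (lift y₂ c) ≫ f := by
  have := hC.isProper
  have := hC.smooth
  have := hC.geometricallyIntegral
  have := isSeparated_left A.X
  let R := Over.map (specMap k E)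
  let f₁ : R.obj ((Q ⊗ Q) ⊗ C.X) ⟶ A.X := R.map (lift (fst _ _ ≫ fst _ _) (snd _ _)) ≫ f
  let f₂ : R.obj ((Q ⊗ Q) ⊗ C.X) ⟶ A.X := R.map (lift (fst _ _ ≫ snd _ _) (snd _ _)) ≫ f
  have hQ : IsIntegral Q.left := GeometricallyIntegral.isIntegral_of_subsingleton Q.hom
  have : IsLocallyNoetherian (Q ⊗ C.X).left := by
    have : LocallyOfFiniteType (fst Q C.X).left := by dsimp; infer_instance
    exact LocallyOfFiniteType.isLocallyNoetherian (fst Q C.X).left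
  have : IsIntegral (Q ⊗ C.X).left := by dsimp; infer_instance
  have : IsIntegral (Q ⊗ Q ⊗ C.X).left :=
    inferInstanceAs (IsIntegral (pullback Q.hom (Q ⊗ C.X).hom))
  have : IsIso (α_ Q Q C.X).hom.left :=
    inferInstanceAs (IsIso ((Over.forget _).map (α_ Q Q C.X).hom))
  have : Nonempty (R.obj ((Q ⊗ Q) ⊗ C.X)).left := .map (α_ Q Q C.X).inv.left inferInstance
  have : IsIntegral (R.obj ((Q ⊗ Q) ⊗ C.X)).left :=
    isIntegral_of_isOpenImmersion (α_ Q Q C.X).hom.left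
  have : IsProper (R.map (fst (Q ⊗ Q) C.X)).left := by dsimp [R]; infer_instance
  have : GeometricallyIntegral (R.map (fst (Q ⊗ Q) C.X)).left := by dsimp [R]; infer_instance
  have : Nonempty (R.obj Q).left := inferInstanceAs (Nonempty Q.left)
  have h := rigidity_over (R.map (fst (Q ⊗ Q) C.X)) (R.map (lift (𝟙 _) 1))
    (by rw [← R.map_comp, lift_fst, R.map_id]) (f₁ * f₂⁻¹) (S₀ := R.obj Q) (R.map (lift (𝟙 Q) (𝟙 Q)))
    1 fun Z a b hab ↦ by
      rw [MonObj.comp_mul, GrpObj.comp_inv, MonObj.comp_one, mul_inv_eq_one]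
      have h₁ : a ≫ R.map (fst _ _ ≫ fst _ _) = b := by
        have := hab =≫ R.map (fst _ _)
        rwa [Category.assoc, Category.assoc, ← R.map_comp, ← R.map_comp, lift_fst, R.map_id,
          Category.comp_id] at this
      have h₂ : a ≫ R.map (fst _ _ ≫ snd _ _) = b := by
        have := hab =≫ R.map (snd _ _)
        rwa [Category.assoc, Category.assoc, ← R.map_comp, ← R.map_comp, lift_snd, R.map_id,
          Category.comp_id] at this
      have h : a ≫ R.map (lift (fst _ _ ≫ fst _ _) (snd _ _)) =
          a ≫ R.map (lift (fst _ _ ≫ snd _ _) (snd _ _)) := by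
        ext1
        refine pullback.hom_ext ?_ ?_
        · have := congr(Over.Hom.left $(h₁.trans h₂.symm))
          simpa [R, pullback.lift_fst] using this
        · simp [R, pullback.lift_snd]
      rw [reassoc_of% h]
  have h₀ : R.map (lift (𝟙 (Q ⊗ Q)) (1 : _ ⟶ C.X)) ≫ f₁ = 1 := by
    rw [← R.map_comp_assoc, show lift (𝟙 (Q ⊗ Q)) (1 : _ ⟶ C.X) ≫ lift (fst _ _ ≫ fst _ _) (snd _ _) =
      fst Q Q ≫ lift (𝟙 Q) 1 by ext1 <;> simp, R.map_comp_assoc, hf, MonObj.comp_one]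
  have h₀' : R.map (lift (𝟙 (Q ⊗ Q)) (1 : _ ⟶ C.X)) ≫ f₂ = 1 := by
    rw [← R.map_comp_assoc, show lift (𝟙 (Q ⊗ Q)) (1 : _ ⟶ C.X) ≫ lift (fst _ _ ≫ snd _ _) (snd _ _) =
      snd Q Q ≫ lift (𝟙 Q) 1 by ext1 <;> simp, R.map_comp_assoc, hf, MonObj.comp_one]
  rw [MonObj.comp_mul, GrpObj.comp_inv, h₀, h₀', inv_one, mul_one, MonObj.comp_one, eq_comm,
    mul_inv_eq_one] at h
  have := R.map (lift (lift y₁ y₂) c) ≫= h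
  simp only [f₁, f₂, ← Category.assoc, ← R.map_comp, comp_lift] at this
  simpa using this

/-! ### Isotrivial abelian varieties and their traces -/

lemma IsAbelianVariety.baseChange {k K : Type} [Field k] [Field K] [Algebra k K]
    {A : GroupScheme k} (hA : IsAbelianVariety A) :
    IsAbelianVariety ((IsotrivialTrace.baseChange k K).obj A) where
  isProper :=
    have := hA.isProper
    inferInstanceAs (IsProper (pullback.snd A.X.hom (specMap k K)))
  smooth :=
    have := hA.smooth
    inferInstanceAs (Smooth (pullback.snd A.X.hom (specMap k K)))
  geometricallyIntegral :=
    have := hA.geometricallyIntegral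
    inferInstanceAs (GeometricallyIntegral (pullback.snd A.X.hom (specMap k K)))

lemma one_left {S : Scheme.{0}} {M T : Over S} [MonObj M] :
    (1 : T ⟶ M).left = T.hom ≫ η[M].left := by
  rw [Hom.one_def]
  rfl

/-- A splitting of the group scheme `V` over `K`: a torsor `P` over `Spec K` for the finite group
`G`, and an isomorphism of `V` with the quotient of `P × A` by the diagonal action of `G`. The
isomorphism is encoded as a morphism `φ : P × A ⟶ V` over `K` such that `(y, a) ↦ (y, φ (y, a))` is
an isomorphism from `P × A` to the fibre product of `P` and `V` over `K`; products of complex schemes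
are formed over `ℂ`. -/
structure Splitting {G : Type} [Group G] {A : GroupScheme ℂ} (act : G →* Aut A) {K : Type} [Field K]
    [Algebra ℂ K] (V : GroupScheme K) where
  /-- The torsor. -/
  P : Over (Spec (CommRingCat.of K))
  isFinite : IsFinite P.hom
  isIntegral : IsIntegral P.left
  /-- The quotient map `P × A ⟶ V`. -/
  φ : (Over.map (specMap ℂ K)).obj P ⊗ A.X ⟶ (Over.map (specMap ℂ K)).obj V.X
  φ_comp : φ.left ≫ V.X.hom = (fst ((Over.map (specMap ℂ K)).obj P) A.X).left ≫ P.hom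
  existsUnique : ∀ {T : Over (Spec (CommRingCat.of ℂ))} (y : T ⟶ (Over.map (specMap ℂ K)).obj P)
    (v : T ⟶ (Over.map (specMap ℂ K)).obj V.X), y.left ≫ P.hom = v.left ≫ V.X.hom →
    ∃! a : T ⟶ A.X, lift y a ≫ φ = v
  φ_one : ∀ {T : Over (Spec (CommRingCat.of ℂ))} (y : T ⟶ (Over.map (specMap ℂ K)).obj P),
    (lift y 1 ≫ φ).left = y.left ≫ P.hom ≫ η[V.X].left
  /-- The action of `G` on `P`. -/
  deck : G → (P ⟶ P)
  equivariant : ∀ (g : G) {T : Over (Spec (CommRingCat.of ℂ))}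
    (y : T ⟶ (Over.map (specMap ℂ K)).obj P) (a : T ⟶ A.X),
    lift (y ≫ (Over.map (specMap ℂ K)).map (deck g)) (a ≫ (act g).hom.hom.hom) ≫ φ = lift y a ≫ φ
  /-- Locally, two points of `P` over the same point of `Spec K` differ by an element of `G`. -/
  hom_ext : ∀ {T Z : Over (Spec (CommRingCat.of ℂ))} (y₁ y₂ : T ⟶ (Over.map (specMap ℂ K)).obj P),
    y₁.left ≫ P.hom = y₂.left ≫ P.hom → ∀ u v : T ⟶ Z,
    (∀ (g : G) (T' : Over (Spec (CommRingCat.of ℂ))) (j : T' ⟶ T),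
      j ≫ y₂ = j ≫ y₁ ≫ (Over.map (specMap ℂ K)).map (deck g) → j ≫ u = j ≫ v) → u = v

namespace Splitting

variable {G : Type} [Group G] {A : GroupScheme ℂ} {act : G →* Aut A} {K : Type} [Field K]
  [Algebra ℂ K] {V : GroupScheme K} (s : Splitting act V)

lemma eq_of_lift_comp_eq {T : Over (Spec (CommRingCat.of ℂ))}
    (y : T ⟶ (Over.map (specMap ℂ K)).obj s.P) {a b : T ⟶ A.X}
    (h : lift y a ≫ s.φ = lift y b ≫ s.φ) : a = b := by
  refine (s.existsUnique y (lift y b ≫ s.φ) ?_).unique h rfl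
  rw [Over.comp_left, Category.assoc, s.φ_comp, ← Category.assoc, ← Over.comp_left, lift_fst]

instance : IsFinite s.P.hom := s.isFinite

instance : IsIntegral s.P.left := s.isIntegral

instance : Surjective s.P.hom :=
  ⟨fun _ ↦ ⟨Classical.arbitrary _, Subsingleton.elim (α := PrimeSpectrum K) _ _⟩⟩

instance : IsAffine s.P.left := isAffine_of_isAffineHom s.P.hom

instance : GeometricallyIntegral (s.P.hom ≫ specMap ℂ K) := by
  have : IsLocallyNoetherian s.P.left := LocallyOfFiniteType.isLocallyNoetherian s.P.hom
  exact geometricallyIntegral_of_isAlgClosed _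

/-- The value of `φ (y, a)` does not depend on `y` if `a` is fixed by `G`. -/
lemma lift_comp_eq_of_isFixed {T : Over (Spec (CommRingCat.of ℂ))}
    (y₁ y₂ : T ⟶ (Over.map (specMap ℂ K)).obj s.P) (hy : y₁.left ≫ s.P.hom = y₂.left ≫ s.P.hom)
    {a : T ⟶ A.X} (ha : IsFixed act a) : lift y₁ a ≫ s.φ = lift y₂ a ≫ s.φ := by
  refine s.hom_ext y₁ y₂ hy _ _ fun g T' j hj ↦ ?_
  rw [← Category.assoc, ← Category.assoc, comp_lift, comp_lift, hj, ← s.equivariant g (j ≫ y₁),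
    Category.assoc, Category.assoc, ha g]

/-- The homomorphism `B ⊗ K ⟶ V` obtained from `P × B ⟶ P × A ⟶ V` by descent. -/
lemma exists_hom_baseChange [IsSeparated V.X.hom] {B : GroupScheme ℂ} (hB : IsAbelianVariety B) (j : B ⟶ A)
    (hj : IsFixed act j.hom.hom) :
    ∃ τ : (baseChange ℂ K).obj B ⟶ V, ∀ {T : Over (Spec (CommRingCat.of ℂ))}
      (y : T ⟶ (Over.map (specMap ℂ K)).obj s.P) (b : T ⟶ B.X)
      (z : T.left ⟶ ((baseChange ℂ K).obj B).X.left), z ≫ baseChangeFst ℂ K B = b.left →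
      z ≫ ((baseChange ℂ K).obj B).X.hom = y.left ≫ s.P.hom →
      z ≫ τ.hom.hom.left = (lift y (b ≫ j.hom.hom) ≫ s.φ).left := by
  let R := Over.map (specMap ℂ K)
  let BK := (baseChange ℂ K).obj B
  let pr : R.obj BK.X ⟶ B.X := Over.homMk (baseChangeFst ℂ K B) (baseChangeFst_condition B)
  let e : R.obj (s.P ⊗ BK.X) ⟶ R.obj V.X :=
    lift (R.map (fst _ _)) (R.map (snd _ _) ≫ pr ≫ j.hom.hom) ≫ s.φ
  have : Flat (R.map (snd s.P BK.X)).left := by dsimp [R]; infer_instance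
  have : Surjective (R.map (snd s.P BK.X)).left := by dsimp [R]; infer_instance
  have : QuasiCompact (R.map (snd s.P BK.X)).left := by dsimp [R]; infer_instance
  obtain ⟨d, hd⟩ := exists_desc (R.map (snd s.P BK.X)) e fun T a b hab ↦ by
    have hy : (a ≫ R.map (fst _ _)).left ≫ s.P.hom = (b ≫ R.map (fst _ _)).left ≫ s.P.hom := by
      have h (c : T ⟶ R.obj (s.P ⊗ BK.X)) : (c ≫ R.map (fst _ _)).left ≫ s.P.hom =
          (c ≫ R.map (snd _ _)).left ≫ BK.X.hom := by
        rw [Over.comp_left, Over.comp_left, Category.assoc, Category.assoc]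
        congr 1
        exact pullback.condition
      rw [h, h, hab]
    simp only [e, ← Category.assoc, comp_lift]
    rw [hab]
    exact s.lift_comp_eq_of_isFixed _ _ hy (hj.comp _)
  have hd' {T : Over (Spec (CommRingCat.of ℂ))}
      (y : T ⟶ R.obj s.P) (b : T ⟶ B.X)
      (z : T.left ⟶ BK.X.left) (hz : z ≫ baseChangeFst ℂ K B = b.left)
      (hz' : z ≫ BK.X.hom = y.left ≫ s.P.hom) :
      z ≫ d.left = (lift y (b ≫ j.hom.hom) ≫ s.φ).left := by
    let w : T ⟶ R.obj (s.P ⊗ BK.X) := Over.homMk (pullback.lift y.left z hz'.symm) (by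
      refine Eq.trans ?_ (Over.w y)
      simp [R, pullback.lift_fst_assoc])
    have hw : w ≫ R.map (fst _ _) = y := by ext1; exact pullback.lift_fst _ _ _
    have hw' : (w ≫ R.map (snd _ _)).left = z := pullback.lift_snd _ _ _
    have hw'' : (w ≫ R.map (snd _ _)) ≫ pr = b := by
      ext1
      rw [Over.comp_left, hw']
      exact hz
    rw [← hw', ← Over.comp_left, Category.assoc, hd, ← Category.assoc, comp_lift, hw,
      ← Category.assoc, ← Category.assoc, hw'']
  have hdV : d.left ≫ V.X.hom = BK.X.hom := by
    rw [← cancel_epi (R.map (snd s.P BK.X)).left, ← Category.assoc, ← Over.comp_left, hd,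
      Over.comp_left, Category.assoc, s.φ_comp, ← Category.assoc, ← Over.comp_left, lift_fst]
    exact pullback.condition
  let τ : BK.X ⟶ V.X := Over.homMk d.left hdV
  have hτ : η[BK.X] ≫ τ = η[V.X] := by
    ext1
    rw [← cancel_epi s.P.hom]
    have h := hd' (𝟙 _) 1 (1 : s.P ⟶ BK.X).left ?_ ?_
    · rw [MonObj.one_comp, s.φ_one] at h
      rw [Over.comp_left, ← Category.assoc, ← one_left]
      exact h.trans (Category.id_comp _)
    · rw [one_baseChange, one_left]
      exact (Category.assoc _ _ _).symm
    · rw [Over.w]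
      exact (Category.id_comp _).symm
  have := isMonHom_of_one_comp hB.baseChange τ hτ
  exact ⟨Grp.homMk τ, fun y b z hz hz' ↦ hd' y b z hz hz'⟩

end Splitting

/-- If `X` lies over `S'` and `P` over `S`, which itself lies over `S'`, then `P ×_{S'} X` is the base
change of `P` along `X ×_{S'} S ⟶ S`. -/
lemma isPullback_lift_snd {C : Type*} [Category* C] [HasPullbacks C] {P S S' X : C} (u : P ⟶ S)
    (w : S ⟶ S') (c : X ⟶ S') :
    IsPullback (pullback.lift (pullback.snd (u ≫ w) c) (pullback.fst (u ≫ w) c ≫ u)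
      (by rw [Category.assoc, pullback.condition])) (pullback.fst (u ≫ w) c)
      (pullback.snd c w) u := by
  refine ⟨⟨pullback.lift_snd _ _ _⟩, ⟨PullbackCone.IsLimit.mk _
    (fun s ↦ pullback.lift s.snd (s.fst ≫ pullback.fst _ _) ?_) ?_ ?_ ?_⟩⟩
  · rw [Category.assoc, pullback.condition, ← reassoc_of% s.condition]
  · intro s
    ext1
    · simp [pullback.lift_fst, pullback.lift_snd]
    · simpa [pullback.lift_fst_assoc, pullback.lift_snd] using s.condition.symm
  · intro s
    simp [pullback.lift_fst]
  · intro s m h₁ h₂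
    ext1
    · simpa [pullback.lift_fst] using h₂
    · simpa [pullback.lift_fst, pullback.lift_snd] using h₁ =≫ pullback.fst _ _

namespace Splitting

variable {G : Type} [Group G] {A : GroupScheme ℂ} {act : G →* Aut A} {K : Type} [Field K]
  [Algebra ℂ K] {V : GroupScheme K} (s : Splitting act V)
  (E L : Type) [Field E] [Field L] [Algebra E L] [Algebra K L]

/-- The torsor `P ⊗_K L`, as a scheme over the subfield `E` of `L`. -/
noncomputable def torsorOver : Over (Spec (CommRingCat.of E)) :=
  Over.mk (pullback.snd s.P.hom (specMap K L) ≫ specMap E L)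

/-- The structure morphism of `P ⊗_K L`. -/
noncomputable def torsorSnd : (s.torsorOver E L).left ⟶ Spec (CommRingCat.of L) :=
  pullback.snd s.P.hom (specMap K L)

instance : Flat (s.torsorSnd E L) := inferInstanceAs (Flat (pullback.snd _ _))

instance : Surjective (s.torsorSnd E L) := inferInstanceAs (Surjective (pullback.snd _ _))

instance : IsFinite (s.torsorSnd E L) := inferInstanceAs (IsFinite (pullback.snd _ _))

instance : IsLocallyNoetherian (s.torsorOver E L).left :=
  LocallyOfFiniteType.isLocallyNoetherian (s.torsorSnd E L)

instance : Flat (s.torsorOver E L).hom :=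
  inferInstanceAs (Flat (s.torsorSnd E L ≫ specMap E L))

instance : Surjective (s.torsorOver E L).hom :=
  inferInstanceAs (Surjective (s.torsorSnd E L ≫ specMap E L))

instance : QuasiCompact (s.torsorOver E L).hom :=
  inferInstanceAs (QuasiCompact (s.torsorSnd E L ≫ specMap E L))

/-- The morphism from `(P ⊗_K L) × C` to `C ⊗_E L` is faithfully flat and quasi-compact, hence an
epimorphism. -/
lemma exists_toBaseChange (C : GroupScheme E) :
    ∃ m : (s.torsorOver E L ⊗ C.X).left ⟶ ((baseChange E L).obj C).X.left,
    Epi m ∧ m ≫ baseChangeFst E L C = (snd (s.torsorOver E L) C.X).left ∧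
    m ≫ ((baseChange E L).obj C).X.hom = (fst (s.torsorOver E L) C.X).left ≫ s.torsorSnd E L := by
  have h := isPullback_lift_snd (pullback.snd s.P.hom (specMap K L)) (specMap E L) C.X.hom
  let m : (s.torsorOver E L ⊗ C.X).left ⟶ ((baseChange E L).obj C).X.left :=
    pullback.lift (snd (s.torsorOver E L) C.X).left
      ((fst (s.torsorOver E L) C.X).left ≫ s.torsorSnd E L) (by
        rw [Over.w, Category.assoc, ← Over.w (fst (s.torsorOver E L) C.X)]
        rfl)
  have h' : IsPullback (fst (s.torsorOver E L) C.X).left m (s.torsorSnd E L)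
    ((baseChange E L).obj C).X.hom := h.flip
  have := MorphismProperty.of_isPullback (P := @Flat) h' inferInstance
  have := MorphismProperty.of_isPullback (P := @Surjective) h' inferInstance
  have := MorphismProperty.of_isPullback (P := @QuasiCompact) h' inferInstance
  exact ⟨m, inferInstance, pullback.lift_fst _ _ _, h'.w.symm⟩

variable [Algebra ℂ E] [Algebra ℂ L] [IsScalarTower ℂ E L] [IsScalarTower ℂ K L]

/-- The projection from `P ⊗_K L` to `P`. -/
noncomputable def torsorFst :
    (Over.map (specMap ℂ E)).obj (s.torsorOver E L) ⟶ (Over.map (specMap ℂ K)).obj s.P :=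
  Over.homMk (pullback.fst s.P.hom (specMap K L)) (by
    have h : pullback.fst s.P.hom (specMap K L) ≫ s.P.hom ≫ specMap ℂ K =
        (pullback.snd s.P.hom (specMap K L) ≫ specMap E L) ≫ specMap ℂ E := by
      rw [pullback.condition_assoc, Category.assoc, ← specMap_comp, ← specMap_comp]
    exact h)

lemma torsorFst_left_comp :
    (s.torsorFst E L).left ≫ s.P.hom = s.torsorSnd E L ≫ specMap K L :=
  pullback.condition

/-- The action of `G` on `P`, base changed to `L`. -/
lemma exists_torsorDeck (g : G) : ∃ d : s.torsorOver E L ⟶ s.torsorOver E L,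
    (Over.map (specMap ℂ E)).map d ≫ s.torsorFst E L =
      s.torsorFst E L ≫ (Over.map (specMap ℂ K)).map (s.deck g) ∧
    d.left ≫ s.torsorSnd E L = s.torsorSnd E L := by
  let l : pullback s.P.hom (specMap K L) ⟶ pullback s.P.hom (specMap K L) :=
    pullback.lift (pullback.fst _ _ ≫ (s.deck g).left) (pullback.snd _ _) (by
      rw [Category.assoc, Over.w, pullback.condition])
  have h₁ : l ≫ pullback.fst _ _ = pullback.fst _ _ ≫ (s.deck g).left := pullback.lift_fst _ _ _
  have h₂ : l ≫ pullback.snd _ _ = pullback.snd _ _ := pullback.lift_snd _ _ _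
  exact ⟨Over.homMk l (by
    change l ≫ _ ≫ _ = _
    rw [reassoc_of% h₂]
    rfl), by ext1; exact h₁, h₂⟩

variable {E L} {C : GroupScheme E}

variable {m : (s.torsorOver E L ⊗ C.X).left ⟶ ((baseChange E L).obj C).X.left}

/-- The equation `α (l, c) = φ (y, f (y, c))` has a solution `f`, since `φ` identifies `P × A` with
`P × V`. -/
lemma exists_lift_comp_eq (hm : m ≫ ((baseChange E L).obj C).X.hom =
      (fst (s.torsorOver E L) C.X).left ≫ s.torsorSnd E L)
    (α : (baseChange E L).obj C ⟶ (baseChange K L).obj V) :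
    ∃ f : (Over.map (specMap ℂ E)).obj (s.torsorOver E L ⊗ C.X) ⟶ A.X,
      (lift ((Over.map (specMap ℂ E)).map (fst _ _) ≫ s.torsorFst E L) f ≫ s.φ).left =
        m ≫ α.hom.hom.left ≫ baseChangeFst K L V := by
  let R := Over.map (specMap ℂ E)
  let y := R.map (fst (s.torsorOver E L) C.X) ≫ s.torsorFst E L
  let t := m ≫ α.hom.hom.left ≫ baseChangeFst K L V
  have h : y.left ≫ s.P.hom = t ≫ V.X.hom := by
    simp only [t, Category.assoc]
    rw [baseChangeFst_condition, Over.w_assoc, reassoc_of% hm, ← torsorFst_left_comp]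
    exact Category.assoc _ _ _
  let v : R.obj (s.torsorOver E L ⊗ C.X) ⟶ (Over.map (specMap ℂ K)).obj V.X := Over.homMk t (by
    rw [← Over.w y]
    exact ((reassoc_of% h) _).symm)
  obtain ⟨f, hf, -⟩ := s.existsUnique y v h
  exact ⟨f, congr($(hf).left)⟩

variable {f : (Over.map (specMap ℂ E)).obj (s.torsorOver E L ⊗ C.X) ⟶ A.X}

/-- The solution `f` of `α (l, c) = φ (y, f (y, c))` satisfies `f (y, 0) = 0`. -/
lemma map_lift_one_comp_eq_one (hm : m ≫ baseChangeFst E L C = (snd (s.torsorOver E L) C.X).left)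
    (hm' : m ≫ ((baseChange E L).obj C).X.hom =
      (fst (s.torsorOver E L) C.X).left ≫ s.torsorSnd E L)
    (α : (baseChange E L).obj C ⟶ (baseChange K L).obj V)
    (hf : (lift ((Over.map (specMap ℂ E)).map (fst _ _) ≫ s.torsorFst E L) f ≫ s.φ).left =
        m ≫ α.hom.hom.left ≫ baseChangeFst K L V) :
    (Over.map (specMap ℂ E)).map (lift (𝟙 _) 1) ≫ f = 1 := by
  let R := Over.map (specMap ℂ E)
  refine s.eq_of_lift_comp_eq (s.torsorFst E L) ?_
  ext1
  have h₁ : lift (s.torsorFst E L) (R.map (lift (𝟙 _) (1 : s.torsorOver E L ⟶ C.X)) ≫ f) =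
      R.map (lift (𝟙 _) 1) ≫ lift (R.map (fst _ _) ≫ s.torsorFst E L) f := by
    rw [comp_lift, ← R.map_comp_assoc, lift_fst, R.map_id, Category.id_comp]
  let T : Over (Spec (CommRingCat.of L)) := Over.mk (s.torsorSnd E L)
  have h₂ : (lift (𝟙 _) (1 : s.torsorOver E L ⟶ C.X)).left ≫ m =
      (1 : T ⟶ ((baseChange E L).obj C).X).left := by
    let u : T ⟶ ((baseChange E L).obj C).X :=
      Over.homMk ((lift (𝟙 _) (1 : s.torsorOver E L ⟶ C.X)).left ≫ m) (by
        rw [Category.assoc, hm', ← Over.comp_left_assoc, lift_fst]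
        exact Category.id_comp _)
    have hu : u = 1 := by
      refine hom_ext_baseChange ?_
      rw [one_baseChange]
      change (_ ≫ m) ≫ _ = _
      rw [Category.assoc, hm, ← Over.comp_left, lift_snd, one_left]
      exact Category.assoc _ _ _
    exact congr($(hu).left)
  have h₃ : (1 : T ⟶ ((baseChange E L).obj C).X) ≫ α.hom.hom = 1 := MonObj.one_comp _
  rw [s.φ_one, reassoc_of% s.torsorFst_left_comp E L, h₁, Category.assoc, Over.comp_left, hf]
  change (lift (𝟙 _) (1 : s.torsorOver E L ⟶ C.X)).left ≫ m ≫ _ = _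
  rw [reassoc_of% h₂, ← Over.comp_left_assoc, h₃, one_baseChange]
  rfl

/-- By rigidity the solution `f` of `α (l, c) = φ (y, f (y, c))` does not depend on `y`, and so it
descends to a morphism `β` on `C`. Both `f (g y, c)` and `g (f (y, c))` solve the equation with
`g y` in place of `y`; hence `β` is fixed by `G`. -/
lemma exists_descent_isFixed (hA : IsAbelianVariety A) (hC : IsAbelianVariety C)
    (hf₁ : (Over.map (specMap ℂ E)).map (lift (𝟙 _) 1) ≫ f = 1)
    (hm' : m ≫ ((baseChange E L).obj C).X.hom =
      (fst (s.torsorOver E L) C.X).left ≫ s.torsorSnd E L)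
    (hm : m ≫ baseChangeFst E L C = (snd (s.torsorOver E L) C.X).left)
    [GeometricallyIntegral (s.torsorOver E L).hom]
    (α : (baseChange E L).obj C ⟶ (baseChange K L).obj V)
    (hf : (lift ((Over.map (specMap ℂ E)).map (fst _ _) ≫ s.torsorFst E L) f ≫ s.φ).left =
        m ≫ α.hom.hom.left ≫ baseChangeFst K L V) :
    ∃ β : (Over.map (specMap ℂ E)).obj C.X ⟶ A.X, IsFixed act β ∧
      (Over.map (specMap ℂ E)).map (snd _ _) ≫ β = f := by
  have := hA.isProper
  have := hC.isProper
  let R := Over.map (specMap ℂ E)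
  have hconst {T : Over (Spec (CommRingCat.of E))} {a b : T ⟶ s.torsorOver E L ⊗ C.X}
      (h : a ≫ snd _ _ = b ≫ snd _ _) : R.map a ≫ f = R.map b ≫ f := by
    rw [← lift_comp_fst_snd a, ← lift_comp_fst_snd b, h]
    exact map_lift_comp_eq hC f hf₁ _ _ _
  have : Flat (R.map (snd (s.torsorOver E L) C.X)).left := by dsimp [R]; infer_instance
  have : Surjective (R.map (snd (s.torsorOver E L) C.X)).left := by dsimp [R]; infer_instance
  have : QuasiCompact (R.map (snd (s.torsorOver E L) C.X)).left := by dsimp [R]; infer_instance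
  have : Epi (R.map (snd (s.torsorOver E L) C.X)) :=
    (Over.forget _).epi_of_epi_map
      (inferInstanceAs (Epi (R.map (snd (s.torsorOver E L) C.X)).left))
  obtain ⟨β, hβ⟩ := exists_desc (R.map (snd _ _)) f fun T a b hab ↦ by
    let T' : Over (Spec (CommRingCat.of E)) := Over.mk (a.left ≫ (s.torsorOver E L ⊗ C.X).hom)
    have hab' : a.left ≫ (snd (s.torsorOver E L) C.X).left =
        b.left ≫ (snd (s.torsorOver E L) C.X).left := congr($(hab).left)
    let a' : T' ⟶ s.torsorOver E L ⊗ C.X := Over.homMk a.left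
    let b' : T' ⟶ s.torsorOver E L ⊗ C.X := Over.homMk b.left (by
      rw [← Over.w (snd (s.torsorOver E L) C.X), ← reassoc_of% hab', Over.w]
      rfl)
    ext1
    exact congr($(hconst (show a' ≫ snd _ _ = b' ≫ snd _ _ by ext1; exact hab')).left)
  refine ⟨β, fun g ↦ ?_, hβ⟩
  rw [← cancel_epi (R.map (snd (s.torsorOver E L) C.X)), reassoc_of% hβ, hβ]
  obtain ⟨d, hd, hd'⟩ := s.exists_torsorDeck E L g
  let x : s.torsorOver E L ⊗ C.X ⟶ s.torsorOver E L ⊗ C.X := lift (fst _ _ ≫ d) (snd _ _)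
  let y := R.map (fst (s.torsorOver E L) C.X) ≫ s.torsorFst E L
  have hxm : x.left ≫ m = m := by
    refine pullback.hom_ext ?_ ?_
    · change (x.left ≫ m) ≫ baseChangeFst E L C = m ≫ baseChangeFst E L C
      rw [Category.assoc, hm, ← Over.comp_left, lift_snd]
    · change (x.left ≫ m) ≫ ((baseChange E L).obj C).X.hom = m ≫ ((baseChange E L).obj C).X.hom
      rw [Category.assoc, hm', ← Over.comp_left_assoc, lift_fst, Over.comp_left, Category.assoc,
        hd']
  have hxf : R.map x ≫ f = f := by
    rw [hconst (b := 𝟙 _) (by rw [lift_snd, Category.id_comp]), R.map_id, Category.id_comp]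
  have hxy : R.map x ≫ y = y ≫ (Over.map (specMap ℂ K)).map (s.deck g) := by
    rw [← R.map_comp_assoc, lift_fst, R.map_comp, Category.assoc, hd, Category.assoc]
  have hx : lift (y ≫ (Over.map (specMap ℂ K)).map (s.deck g)) f ≫ s.φ = lift y f ≫ s.φ := by
    have h : R.map x ≫ lift y f = lift (y ≫ (Over.map (specMap ℂ K)).map (s.deck g)) f := by
      rw [comp_lift, hxf, hxy]
    rw [← h, Category.assoc]
    ext1
    rw [Over.comp_left, hf]
    change x.left ≫ m ≫ _ = _
    rw [reassoc_of% hxm]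
  exact s.eq_of_lift_comp_eq _ ((s.equivariant g y f).trans hx.symm)

/-- The maximal fixed abelian subvariety of the fibre is the trace of an isotrivial abelian variety:
a homomorphism from `C ⊗_E L` to `V ⊗_K L` is given by a morphism `f` from `(P ⊗_K L) × C` to `A`
that vanishes on the zero section. By rigidity, `f` comes from a morphism from `C` to `A`; the
latter is fixed by `G`. -/
lemma isTrace (s : Splitting act V) [IsSeparated V.X.hom] (hA : IsAbelianVariety A) {B : GroupScheme ℂ} {j : B ⟶ A}
    (hj : IsMaximalFixedAbelianSubvariety act j) :
    ∃ τ : (baseChange ℂ K).obj B ⟶ V, IsTrace ℂ K V B τ := by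
  have hB := hj.isAbelianVariety
  obtain ⟨τ, hτ⟩ := s.exists_hom_baseChange hB j hj.isFixed
  refine ⟨τ, hB, fun E L _ _ _ _ _ _ _ _ hd hs C hC α ↦ ?_⟩
  have := hA.isProper
  have := hB.isProper
  have := hC.isProper
  have := hC.geometricallyIntegral
  have := hC.smooth
  have := hj.isClosedImmersion
  have : Mono j.hom.hom := (Over.forget _).mono_of_mono_map (inferInstanceAs (Mono j.hom.hom.left))
  have : IsIntegral C.X.left := GeometricallyIntegral.isIntegral_of_subsingleton C.X.hom
  have : GeometricallyIntegral (s.torsorOver E L).hom :=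
    geometricallyIntegral_pullback_snd_comp hd hs s.P.hom
  obtain ⟨m, _, hm, hm'⟩ := s.exists_toBaseChange E L C
  obtain ⟨f, hf⟩ := s.exists_lift_comp_eq hm' α
  have hf₁ := s.map_lift_one_comp_eq_one hm hm' α hf
  obtain ⟨β, hβ, hβf⟩ := s.exists_descent_isFixed hA hC hf₁ hm' hm α hf
  let R := Over.map (specMap ℂ E)
  have : Flat (R.map (snd (s.torsorOver E L) C.X)).left := by dsimp [R]; infer_instance
  have : Surjective (R.map (snd (s.torsorOver E L) C.X)).left := by dsimp [R]; infer_instance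
  have : QuasiCompact (R.map (snd (s.torsorOver E L) C.X)).left := by dsimp [R]; infer_instance
  have : Epi (R.map (snd (s.torsorOver E L) C.X)) :=
    (Over.forget _).epi_of_epi_map
      (inferInstanceAs (Epi (R.map (snd (s.torsorOver E L) C.X)).left))
  have hβ₁ : R.map (1 : s.torsorOver E L ⟶ C.X) ≫ β = 1 := by
    rw [← hf₁, ← hβf, ← R.map_comp_assoc, lift_snd]
  have : IsIntegral (R.obj C.X).left := inferInstanceAs (IsIntegral C.X.left)
  have : Nonempty (R.obj (s.torsorOver E L)).left := by
    have : IsIntegral (s.torsorOver E L).left :=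
      GeometricallyIntegral.isIntegral_of_subsingleton (s.torsorOver E L).hom
    exact inferInstanceAs (Nonempty (s.torsorOver E L).left)
  have : QuasiCompact β.left := by
    have : QuasiCompact (β.left ≫ A.X.hom) := by rw [Over.w]; dsimp [R]; infer_instance
    exact .of_comp _ A.X.hom
  obtain ⟨b, hb⟩ := hj.exists_lift hA β (R.map (1 : s.torsorOver E L ⟶ C.X)) hβ hβ₁
  have hb₁ : R.map (1 : s.torsorOver E L ⟶ C.X) ≫ b = 1 := by
    rw [← cancel_mono j.hom.hom, Category.assoc, hb, hβ₁, MonObj.one_comp]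
  obtain ⟨a', ha'⟩ := exists_lift_baseChange (X := C.X) b.left (Over.w b)
  have ha₁ : (1 : s.torsorOver E L ⟶ C.X) ≫ a' = 1 := by
    refine hom_ext_baseChange ?_
    rw [Over.comp_left, Category.assoc, ha', one_baseChange]
    refine (congr($(hb₁).left)).trans ?_
    rw [one_left]
    exact Category.assoc _ _ _
  have hη : η[C.X] ≫ a' = η[((baseChange ℂ E).obj B).X] := by
    have : Epi (toUnit (s.torsorOver E L)).left :=
      inferInstanceAs (Epi (s.torsorOver E L).hom)
    have : Epi (toUnit (s.torsorOver E L)) := (Over.forget _).epi_of_epi_map this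
    rw [← cancel_epi (toUnit (s.torsorOver E L)), ← Category.assoc, ← Hom.one_def, ← Hom.one_def,
      ha₁]
  have := hB.baseChange (K := E).isProper
  have := isMonHom_of_one_comp hC a' hη
  have key (α' : C ⟶ (baseChange ℂ E).obj B) (b' : R.obj C.X ⟶ B.X)
      (hb' : b'.left = α'.hom.hom.left ≫ baseChangeFst ℂ E B) :
      α = (baseChange E L).map α' ≫ (baseChangeTower ℂ E L).inv.app B ≫
          (baseChangeTower ℂ K L).hom.app B ≫ (baseChange K L).map τ ↔
        f = (R.map (snd _ _) ≫ b') ≫ j.hom.hom := by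
    have hw : (baseChangeFst E L C ≫ b'.left) ≫ B.X.hom =
        (((baseChange E L).obj C).X.hom ≫ specMap K L) ≫ specMap ℂ K := by
      rw [Category.assoc, Over.w, Category.assoc, ← specMap_comp, specMap_comp ℂ E L,
        ← reassoc_of% baseChangeFst_condition (K := L) C]
      rfl
    let z : ((baseChange E L).obj C).X.left ⟶ ((baseChange ℂ K).obj B).X.left :=
      pullback.lift _ _ hw
    have hz : z ≫ baseChangeFst ℂ K B = baseChangeFst E L C ≫ b'.left := pullback.lift_fst _ _ _
    have hz' : z ≫ ((baseChange ℂ K).obj B).X.hom =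
      ((baseChange E L).obj C).X.hom ≫ specMap K L := pullback.lift_snd _ _ _
    rw [eq_baseChange_map_comp_iff τ α α' z (by rw [hz, hb']) hz', ← cancel_epi m, ← hf,
      ← Category.assoc m z, hτ (R.map (fst _ _) ≫ s.torsorFst E L) (R.map (snd _ _) ≫ b') (m ≫ z)
        (by rw [Category.assoc, hz, reassoc_of% hm]; rfl)
        (by rw [Category.assoc, hz', reassoc_of% hm', ← torsorFst_left_comp];
            exact (Category.assoc _ _ _).symm)]
    refine ⟨fun h ↦ s.eq_of_lift_comp_eq _ (by ext1; exact h), fun h ↦ by rw [← h]⟩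
  refine ⟨Grp.homMk a', (key _ b ha'.symm).mpr (by rw [Category.assoc, hb, hβf]), fun α' hα' ↦ ?_⟩
  let b' : R.obj C.X ⟶ B.X := Over.homMk (α'.hom.hom.left ≫ baseChangeFst ℂ E B) (by
    rw [Category.assoc, baseChangeFst_condition, Over.w_assoc]
    rfl)
  have hb' := (key α' b' rfl).mp hα'
  have hbb : b' = b := by
    rwa [← hβf, ← hb, Category.assoc, cancel_epi, cancel_mono, eq_comm] at hb'
  ext1
  exact hom_ext_baseChange (congr($(hbb).left).trans ha'.symm)

end Splitting

/-! ### The splitting of the generic fibre -/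

/-- The generic fibre of a finite surjective morphism to an open subscheme of `X` is integral: over
an affine open subset, it is a localization. -/
lemma isIntegral_pullback_genericPoint {X Y : Scheme.{0}} [IsIntegral X] [IsIntegral Y]
    (U : X.Opens) (s : Y ⟶ U) [Surjective s] [IsAffineHom s]
    (κ : Spec (CommRingCat.of X.functionField) ⟶ U)
    (hκ : κ ≫ U.ι = X.fromSpecStalk (genericPoint X)) : IsIntegral (pullback κ s) := by
  have hηU : genericPoint X ∈ U := by
    rw [← X.fromSpecStalk_closedPoint (x := genericPoint X), ← hκ]
    exact (κ _).2
  obtain ⟨_, ⟨W, hW, rfl⟩, hηW, hWU⟩ := X.isBasis_affineOpens.exists_subset_of_mem_open hηU U.2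
  have hrange : Set.range hW.fromSpec ⊆ Set.range U.ι := by
    rwa [hW.range_fromSpec, Scheme.Opens.range_ι]
  let j : Spec Γ(X, W) ⟶ U := IsOpenImmersion.lift U.ι hW.fromSpec hrange
  have hj : j ≫ U.ι = hW.fromSpec := IsOpenImmersion.lift_fac _ _ _
  have : IsOpenImmersion j := by
    have : IsOpenImmersion (j ≫ U.ι) := by rw [hj]; exact hW.isOpenImmersion_fromSpec
    exact .of_comp _ U.ι
  have : Nonempty W := ⟨_, hηW⟩
  have := functionField_isFractionRing_of_isAffineOpen X W hW
  let r := Spec.map (CommRingCat.ofHom (algebraMap Γ(X, W) X.functionField))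
  have hr : r ≫ j = κ := by
    rw [← cancel_mono U.ι, hκ, Category.assoc, hj]
    exact hW.fromSpecStalk_eq_fromSpecStalk hηW
  have hne (f : Spec (CommRingCat.of X.functionField) ⟶ U) : Nonempty ↥(pullback f s) := by
    obtain ⟨x, -⟩ := (pullback.fst f s).surjective (Classical.arbitrary _)
    exact ⟨x⟩
  let e : pullback r (pullback.fst j s) ≅ pullback (r ≫ j) s := pullbackRightPullbackFstIso _ _ _
  have : Nonempty ↥(pullback r (pullback.fst j s)) := .map e.inv (hne _)
  have : Nonempty ↥(pullback j s) := .map (pullback.snd r (pullback.fst j s)) inferInstance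
  have : IsIntegral (pullback j s) := isIntegral_of_isOpenImmersion (pullback.snd j s)
  have : IsAffine (pullback j s) := isAffine_of_isAffineHom (pullback.fst j s)
  have : IsIntegral (pullback r (pullback.fst j s)) :=
    preservesIntegral_specMap_of_isLocalization (nonZeroDivisors Γ(X, W)) _ _ _
      (IsPullback.of_hasPullback r (pullback.fst j s)).flip inferInstance inferInstance
      inferInstance
  rw [← hr]
  have := hne (r ≫ j)
  exact isIntegral_of_isOpenImmersion e.inv

namespace Splitting

/-- A splitting whose quotient map `φ₀` need not respect the origins can be normalized by
subtracting `φ₀ (y, 0)`. -/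
lemma nonempty_of_quotientMap {G : Type} [Group G] {A : GroupScheme ℂ} {act : G →* Aut A}
    {K : Type} [Field K] [Algebra ℂ K] {V : GroupScheme K}
    (P : Over (Spec (CommRingCat.of K))) (hP : IsFinite P.hom) (hP' : IsIntegral P.left)
    (φ₀ : (Over.map (specMap ℂ K)).obj P ⊗ A.X ⟶ (Over.map (specMap ℂ K)).obj V.X)
    (φ₀_comp : φ₀.left ≫ V.X.hom = (fst ((Over.map (specMap ℂ K)).obj P) A.X).left ≫ P.hom)
    (existsUnique : ∀ {T : Over (Spec (CommRingCat.of ℂ))}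
      (y : T ⟶ (Over.map (specMap ℂ K)).obj P) (v : T ⟶ (Over.map (specMap ℂ K)).obj V.X),
      y.left ≫ P.hom = v.left ≫ V.X.hom → ∃! a : T ⟶ A.X, lift y a ≫ φ₀ = v)
    (deck : G → (P ⟶ P))
    (equivariant : ∀ (g : G) {T : Over (Spec (CommRingCat.of ℂ))}
      (y : T ⟶ (Over.map (specMap ℂ K)).obj P) (a : T ⟶ A.X),
      lift (y ≫ (Over.map (specMap ℂ K)).map (deck g)) (a ≫ (act g).hom.hom.hom) ≫ φ₀ =
        lift y a ≫ φ₀)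
    (hom_ext : ∀ {T Z : Over (Spec (CommRingCat.of ℂ))}
      (y₁ y₂ : T ⟶ (Over.map (specMap ℂ K)).obj P),
      y₁.left ≫ P.hom = y₂.left ≫ P.hom → ∀ u v : T ⟶ Z,
      (∀ (g : G) (T' : Over (Spec (CommRingCat.of ℂ))) (j : T' ⟶ T),
        j ≫ y₂ = j ≫ y₁ ≫ (Over.map (specMap ℂ K)).map (deck g) → j ≫ u = j ≫ v) → u = v) :
    Nonempty (Splitting act V) := by
  let R := Over.map (specMap ℂ K)
  have hcomp {T : Over (Spec (CommRingCat.of ℂ))} (y : T ⟶ R.obj P) (a : T ⟶ A.X) :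
      (lift y a ≫ φ₀).left ≫ V.X.hom = y.left ≫ P.hom := by
    rw [Over.comp_left, Category.assoc, φ₀_comp, ← Over.comp_left_assoc, lift_fst]
  -- The values of `φ₀`, as points of `V` over `K`.
  let val {T : Over (Spec (CommRingCat.of ℂ))} (h : T.left ⟶ Spec (CommRingCat.of K))
      (y : T ⟶ R.obj P) (hy : y.left ≫ P.hom = h) (a : T ⟶ A.X) : Over.mk h ⟶ V.X :=
    Over.homMk (lift y a ≫ φ₀).left ((hcomp y a).trans hy)
  let W : Over (Spec (CommRingCat.of ℂ)) := R.obj P ⊗ A.X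
  let ψ : Over.mk ((fst (R.obj P) A.X).left ≫ P.hom) ⟶ V.X :=
    val (T := W) _ (fst _ _) rfl (snd _ _) * (val (T := W) _ (fst _ _) rfl 1)⁻¹
  have hψ : ψ.left ≫ V.X.hom = (fst (R.obj P) A.X).left ≫ P.hom := Over.w ψ
  let φ : R.obj P ⊗ A.X ⟶ R.obj V.X := Over.homMk ψ.left (by
    change ψ.left ≫ V.X.hom ≫ _ = _
    rw [reassoc_of% hψ, ← Over.w (fst (R.obj P) A.X)]
    rfl)
  have key {T : Over (Spec (CommRingCat.of ℂ))} (h : T.left ⟶ Spec (CommRingCat.of K))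
      (y : T ⟶ R.obj P) (hy : y.left ≫ P.hom = h) (a : T ⟶ A.X) :
      (lift y a ≫ φ).left = (val h y hy a * (val h y hy 1)⁻¹).left := by
    let t : Over.mk h ⟶ Over.mk ((fst (R.obj P) A.X).left ≫ P.hom) := Over.homMk (lift y a).left (by
      change (lift y a).left ≫ (fst (R.obj P) A.X).left ≫ _ = h
      rw [← Over.comp_left_assoc, lift_fst, hy])
    have h₁ (b : W ⟶ A.X) : t ≫ val (T := W) _ (fst _ _) rfl b = val h y hy (lift y a ≫ b) := by
      ext1
      change (lift y a).left ≫ (lift (fst _ _) b ≫ φ₀).left = _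
      rw [← Over.comp_left, ← Category.assoc, comp_lift, lift_fst]
      rfl
    have h₂ : t ≫ ψ = val h y hy a * (val h y hy 1)⁻¹ := by
      rw [MonObj.comp_mul, GrpObj.comp_inv, h₁, h₁, lift_snd, MonObj.comp_one]
    rw [← h₂]
    rfl
  refine ⟨⟨P, hP, hP', φ, hψ, fun {T} y v hyv ↦ ?_, fun {T} y ↦ ?_, deck, fun g {T} y a ↦ ?_,
    hom_ext⟩⟩
  · let vK : Over.mk (y.left ≫ P.hom) ⟶ V.X := Over.homMk v.left hyv.symm
    let v' : T ⟶ R.obj V.X := Over.homMk (vK * val _ y rfl 1).left (by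
      have := Over.w (vK * val _ y rfl 1)
      change _ ≫ V.X.hom ≫ _ = _
      rw [reassoc_of% this, ← Over.w y]
      exact Category.assoc _ _ _)
    have h (a : T ⟶ A.X) : lift y a ≫ φ = v ↔ lift y a ≫ φ₀ = v' := by
      have h₁ : lift y a ≫ φ = v ↔ val _ y rfl a * (val _ y rfl 1)⁻¹ = vK := by
        refine ⟨fun h ↦ ?_, fun h ↦ ?_⟩
        · ext1
          rw [← key _ y rfl a, h]
          rfl
        · ext1
          rw [key _ y rfl, h]
          rfl
      rw [h₁, mul_inv_eq_iff_eq_mul]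
      exact ⟨fun h ↦ by ext1; exact congr($(h).left), fun h ↦ by ext1; exact congr($(h).left)⟩
    simp_rw [h]
    exact existsUnique y v' (Over.w (vK * val _ y rfl 1)).symm
  · rw [key _ y rfl, mul_inv_cancel, one_left]
    exact Category.assoc _ _ _
  · have hy : (y ≫ R.map (deck g)).left ≫ P.hom = y.left ≫ P.hom := by
      rw [Over.comp_left, Category.assoc]
      congr 1
      exact Over.w (deck g)
    have h (b : T ⟶ A.X) : val _ (y ≫ R.map (deck g)) hy (b ≫ (act g).hom.hom.hom) =
        val _ y rfl b := by
      ext1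
      exact congr($(equivariant g y b).left)
    have h₁ := h 1
    rw [MonObj.one_comp] at h₁
    ext1
    rw [key _ _ hy, key _ y rfl, h, h₁]

end Splitting

lemma specMap_functionField (X : Over (Spec (CommRingCat.of ℂ))) [IsIntegral X.left] :
    specMap ℂ X.left.functionField = genericPt X ≫ X.hom :=
  Spec.map_preimage _

/-- Two points of a Galois covering over the same point of the base differ locally by an element of
the Galois group. -/
lemma hom_ext_of_isIso_sigmaDesc {G : Type} {Y U : Scheme.{0}} (s : Y ⟶ U) (d : G → (Y ⟶ Y))
    (hd : ∀ g, 𝟙 Y ≫ s = d g ≫ s)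
    (h : IsIso (Sigma.desc fun g ↦ pullback.lift (f := s) (g := s) (𝟙 Y) (d g) (hd g)))
    {T Z : Scheme.{0}} (y₁ y₂ : T ⟶ Y) (hy : y₁ ≫ s = y₂ ≫ s) (u v : T ⟶ Z)
    (huv : ∀ (g : G) (T' : Scheme.{0}) (j : T' ⟶ T), j ≫ y₂ = j ≫ y₁ ≫ d g → j ≫ u = j ≫ v) :
    u = v := by
  let σ := Sigma.desc fun g ↦ pullback.lift (f := s) (g := s) (𝟙 Y) (d g) (hd g)
  let w : T ⟶ ∐ fun _ : G ↦ Y := pullback.lift y₁ y₂ hy ≫ inv σ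
  have hw : w ≫ σ = pullback.lift y₁ y₂ hy := by simp [w]
  have key (g : G) : pullback.fst w (Sigma.ι (fun _ : G ↦ Y) g) ≫ u =
      pullback.fst w (Sigma.ι (fun _ : G ↦ Y) g) ≫ v := by
    have hg : pullback.fst w (Sigma.ι (fun _ : G ↦ Y) g) ≫ pullback.lift y₁ y₂ hy =
        pullback.snd w (Sigma.ι (fun _ : G ↦ Y) g) ≫ pullback.lift (𝟙 Y) (d g) (hd g) := by
      rw [← hw, pullback.condition_assoc, Sigma.ι_desc]
    have h₁ := hg =≫ pullback.fst _ _
    have h₂ := hg =≫ pullback.snd _ _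
    rw [Category.assoc, Category.assoc, pullback.lift_fst, pullback.lift_fst,
      Category.comp_id] at h₁
    rw [Category.assoc, Category.assoc, pullback.lift_snd, pullback.lift_snd] at h₂
    exact huv g _ _ (by rw [reassoc_of% h₁, h₂])
  exact Scheme.Cover.hom_ext ((sigmaOpenCover fun _ : G ↦ Y).pullback₁ w) _ _ key

variable {𝒜 X : Over (Spec (CommRingCat.of ℂ))} {π : 𝒜 ⟶ X}

/-- The holonomy datum of a family splits its generic fibre. -/
lemma HolonomyDatum.nonempty_splitting [IsIntegral X.left] [GrpObj (genericFibre π)]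
    {M : 𝒜.left.Modules} {G : Type} [Group G] (D : HolonomyDatum π M G) :
    Nonempty (Splitting D.act (Grp.mk (genericFibre π))) := by
  let K := X.left.functionField
  let R := Over.map (specMap ℂ K)
  have := D.isIntegral
  have := D.isFinite
  have := D.surjective
  -- The generic point of `X` lies in the open set `U`.
  have hrange : Set.range (genericPt X) ⊆ Set.range D.U.ι := by
    rw [Scheme.Opens.range_ι]
    rintro _ ⟨t, rfl⟩
    obtain rfl : t = IsLocalRing.closedPoint K := Subsingleton.elim (α := PrimeSpectrum K) _ _
    have h : genericPt X (IsLocalRing.closedPoint K) = genericPoint X.left :=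
      X.left.fromSpecStalk_closedPoint
    rw [h]
    let u := D.s (genericPoint D.Y)
    exact ((genericPoint_spec X.left).mem_open_set_iff D.U.isOpen).mpr ⟨u.1, trivial, u.2⟩
  let κ : Spec (CommRingCat.of K) ⟶ D.U := IsOpenImmersion.lift D.U.ι (genericPt X) hrange
  have hκ : κ ≫ D.U.ι = genericPt X := IsOpenImmersion.lift_fac _ _ _
  let P : Over (Spec (CommRingCat.of K)) := Over.mk (pullback.fst κ D.s)
  let YC : Over (Spec (CommRingCat.of ℂ)) := Over.mk (D.s ≫ D.U.ι ≫ X.hom)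
  let p : P.left ⟶ D.Y := pullback.snd κ D.s
  have hp : P.hom ≫ genericPt X = p ≫ D.s ≫ D.U.ι := by
    rw [← hκ]
    exact pullback.condition_assoc _
  let κ' : R.obj P ⟶ YC := Over.homMk p (by
    change p ≫ D.s ≫ D.U.ι ≫ X.hom = P.hom ≫ specMap ℂ K
    rw [specMap_functionField, reassoc_of% hp])
  let V := genericFibre π
  let c : V.left ⟶ 𝒜.left := pullback.fst π.left (genericPt X)
  have hc : c ≫ π.left = V.hom ≫ genericPt X := pullback.condition
  have extV {T : Scheme.{0}} {a b : T ⟶ V.left} (h₁ : a ≫ c = b ≫ c)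
    (h₂ : a ≫ V.hom = b ≫ V.hom) : a = b := pullback.hom_ext h₁ h₂
  have extP {T : Scheme.{0}} {a b : T ⟶ P.left} (h₁ : a ≫ P.hom = b ≫ P.hom)
    (h₂ : a ≫ p = b ≫ p) : a = b := pullback.hom_ext h₁ h₂
  let qP : R.obj P ⊗ D.A.X ⟶ 𝒜 := lift (fst _ _ ≫ κ') (snd _ _) ≫ D.q
  have hq : D.q.left ≫ π.left = (fst YC D.A.X).left ≫ D.s ≫ D.U.ι := D.isPullback.w
  have hqP : qP.left ≫ π.left = ((fst (R.obj P) D.A.X).left ≫ P.hom) ≫ genericPt X := by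
    rw [Over.comp_left, Category.assoc, hq, ← Over.comp_left_assoc, lift_fst, Category.assoc, hp]
    exact Category.assoc _ _ _
  let φ₀' : (R.obj P ⊗ D.A.X).left ⟶ V.left := pullback.lift _ _ hqP
  have hφ₁ : φ₀' ≫ c = qP.left := pullback.lift_fst _ _ _
  have hφ₂ : φ₀' ≫ V.hom = (fst (R.obj P) D.A.X).left ≫ P.hom := pullback.lift_snd _ _ _
  let φ₀ : R.obj P ⊗ D.A.X ⟶ R.obj V := Over.homMk φ₀' (by
    change φ₀' ≫ V.hom ≫ _ = _
    rw [reassoc_of% hφ₂, ← Over.w (fst (R.obj P) D.A.X)]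
    rfl)
  have key {T : Over (Spec (CommRingCat.of ℂ))} (y : T ⟶ R.obj P) (a : T ⟶ D.A.X) :
      (lift y a ≫ φ₀).left ≫ c = (lift (y ≫ κ') a ≫ D.q).left := by
    rw [Over.comp_left, Category.assoc]
    change (lift y a).left ≫ φ₀' ≫ c = _
    rw [hφ₁, ← Over.comp_left]
    simp only [qP]
    rw [← Category.assoc, comp_lift, lift_fst_assoc, lift_snd]
  have key' {T : Over (Spec (CommRingCat.of ℂ))} (y : T ⟶ R.obj P) (a : T ⟶ D.A.X) :
      (lift y a ≫ φ₀).left ≫ V.hom = y.left ≫ P.hom := by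
    rw [Over.comp_left, Category.assoc]
    change (lift y a).left ≫ φ₀' ≫ V.hom = _
    rw [hφ₂, ← Over.comp_left_assoc, lift_fst]
  have hdeck (g : G) : (D.deck g).hom.left ≫ D.s = D.s := Over.w (D.deck g).hom
  have hdeckP (g : G) : ∃ d : P ⟶ P, d.left ≫ p = p ≫ (D.deck g).hom.left := by
    let d : P.left ⟶ P.left := pullback.lift P.hom (p ≫ (D.deck g).hom.left) (by
      rw [Category.assoc, hdeck]
      exact pullback.condition)
    exact ⟨Over.homMk d (pullback.lift_fst _ _ _), pullback.lift_snd _ _ _⟩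
  choose deck hdeck' using hdeckP
  refine Splitting.nonempty_of_quotientMap P (inferInstanceAs (IsFinite (pullback.fst κ D.s)))
    (isIntegral_pullback_genericPoint D.U D.s κ hκ) φ₀ hφ₂ (fun {T} y v hyv ↦ ?_) deck
    (fun g {T} y a ↦ ?_) (fun {T Z} y₁ y₂ hy u v huv ↦ ?_)
  · have hw : (v.left ≫ c) ≫ π.left = (y.left ≫ p) ≫ D.s ≫ D.U.ι := by
      rw [Category.assoc, hc, ← reassoc_of% hyv, hp, Category.assoc]
    let l : T.left ⟶ (YC ⊗ D.A.X).left := D.isPullback.lift _ _ hw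
    have hl₁ : l ≫ D.q.left = v.left ≫ c := D.isPullback.lift_fst _ _ _
    have hl₂ : l ≫ (fst YC D.A.X).left = (y ≫ κ').left := D.isPullback.lift_snd _ _ _
    let lC : T ⟶ YC ⊗ D.A.X := Over.homMk l (by
      rw [← Over.w (fst YC D.A.X), reassoc_of% hl₂, Over.w])
    have hlC : lC ≫ fst _ _ = y ≫ κ' := by ext1; exact hl₂
    have hiff (a : T ⟶ D.A.X) : lift y a ≫ φ₀ = v ↔ lift (y ≫ κ') a = lC := by
      constructor
      · intro h
        refine Over.OverMorphism.ext (D.isPullback.hom_ext ?_ ?_)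
        · rw [← Over.comp_left, ← key, h]
          exact hl₁.symm
        · rw [← Over.comp_left, lift_fst]
          exact hl₂.symm
      · intro h
        ext1
        refine extV ?_ ?_
        · rw [key, h]
          exact hl₁
        · rw [key', hyv]
    simp_rw [hiff]
    refine ⟨lC ≫ snd _ _, ?_, fun a h ↦ ?_⟩
    · beta_reduce
      rw [← hlC, lift_comp_fst_snd]
    · rw [← h, lift_snd]
  · let dg : YC ⟶ YC := Over.homMk (D.deck g).hom.left (Over.w_assoc (D.deck g).hom _)
    have hdg : (dg ⊗ₘ (D.act g).hom.hom.hom) ≫ D.q = D.q := D.invariant g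
    have h : (y ≫ R.map (deck g)) ≫ κ' = (y ≫ κ') ≫ dg := by
      ext1
      change (y.left ≫ (deck g).left) ≫ p = (y.left ≫ p) ≫ (D.deck g).hom.left
      rw [Category.assoc, hdeck', Category.assoc]
    ext1
    refine extV ?_ ?_
    · rw [key, key, h, ← lift_map, Category.assoc, hdg]
    · rw [key', key']
      rw [Over.comp_left, Category.assoc]
      congr 1
      exact Over.w (deck g)
  · have hps : p ≫ D.s = P.hom ≫ κ := pullback.condition.symm
    ext1
    refine hom_ext_of_isIso_sigmaDesc D.s (fun g ↦ (D.deck g).hom.left) _ D.galois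
      (y₁.left ≫ p) (y₂.left ≫ p) ?_ u.left v.left fun g T' j hj ↦ ?_
    · rw [Category.assoc, Category.assoc, hps, reassoc_of% hy]
    · let j' : Over.mk (j ≫ T.hom) ⟶ T := Over.homMk j
      refine congr($(huv g _ j' ?_).left)
      ext1
      refine extP ?_ ?_
      · change (j ≫ y₂.left) ≫ P.hom = (j ≫ y₁.left ≫ (deck g).left) ≫ P.hom
        rw [Category.assoc, ← hy, Category.assoc, Category.assoc, Over.w]
      · change (j ≫ y₂.left) ≫ p = (j ≫ y₁.left ≫ (deck g).left) ≫ p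
        rw [Category.assoc, hj, Category.assoc, Category.assoc, Category.assoc, hdeck']

/-! ### Uniqueness of the trace -/

lemma specMap_self (K : Type) [Field K] : specMap K K = 𝟙 _ :=
  Spec.map_id _

lemma exists_hom_baseChange_self {k : Type} [Field k] {V : GroupScheme k}
    (hV : IsAbelianVariety V) : ∃ e : V ⟶ (baseChange k k).obj V,
      e.hom.hom.left ≫ baseChangeFst k k V = 𝟙 _ := by
  have := hV.baseChange (K := k).isProper
  obtain ⟨e, he⟩ := exists_lift_baseChange (X := V.X) (K := k) (A := V) (𝟙 _) (by
    rw [specMap_self, Category.id_comp, Category.comp_id])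
  have := isMonHom_of_one_comp hV e (hom_ext_baseChange (by
    rw [MonObj.one_eq_one (M := ((baseChange k k).obj V).X), one_baseChange, Over.comp_left,
      Category.assoc, he, specMap_self]
    exact (Category.comp_id _).trans
      (((Category.id_comp _).trans (Category.id_comp _)).symm)))
  exact ⟨Grp.homMk e, he⟩

lemma exists_hom_of_baseChange_self {k : Type} [Field k] {V : GroupScheme k}
    (hV : IsAbelianVariety V) : ∃ e : (baseChange k k).obj V ⟶ V,
      e.hom.hom.left = baseChangeFst k k V := by
  have := hV.isProper
  let e : ((baseChange k k).obj V).X ⟶ V.X := Over.homMk (baseChangeFst k k V) (by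
    rw [baseChangeFst_condition, specMap_self, Category.comp_id])
  have := isMonHom_of_one_comp hV.baseChange e (by
    ext1
    rw [MonObj.one_eq_one, Over.comp_left]
    refine (one_baseChange V _).trans ?_
    simp [specMap_self])
  exact ⟨Grp.homMk e, rfl⟩

/-- The universal property of the trace over the ground field. -/
lemma IsTrace.existsUnique_hom {k K : Type} [Field k] [Field K] [Algebra k K] {V : GroupScheme K}
    (hV : IsAbelianVariety V) {B : GroupScheme k} {τ : (baseChange k K).obj B ⟶ V}
    (h : IsTrace k K V B τ) {C : GroupScheme k} (hC : IsAbelianVariety C)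
    (α : (baseChange k K).obj C ⟶ V) : ∃! u : C ⟶ B, α = (baseChange k K).map u ≫ τ := by
  obtain ⟨e, he⟩ := exists_hom_baseChange_self hV
  obtain ⟨b, hb⟩ := exists_hom_baseChange_self h.isAbelianVariety
  obtain ⟨b', hb'⟩ := exists_hom_of_baseChange_self h.isAbelianVariety
  have hd : (IsScalarTower.toAlgHom k k K).fieldRange.LinearDisjoint
      (IsScalarTower.toAlgHom k K K).fieldRange := by
    have h : (IsScalarTower.toAlgHom k k K).fieldRange = ⊥ := by
      ext x
      exact IntermediateField.mem_bot.symm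
    rw [h]
    exact .bot_left _ _ _
  have hs : (IsScalarTower.toAlgHom k k K).fieldRange ⊔
      (IsScalarTower.toAlgHom k K K).fieldRange = ⊤ :=
    top_unique fun x _ ↦ (le_sup_right : _ ≤ _ ⊔ (IsScalarTower.toAlgHom k K K).fieldRange) ⟨x, rfl⟩
  have key (a : C ⟶ (baseChange k k).obj B) :
      α ≫ e = (baseChange k K).map a ≫ (baseChangeTower k k K).inv.app B ≫
        (baseChangeTower k K K).hom.app B ≫ (baseChange K K).map τ ↔
      α = (baseChange k K).map (a ≫ b') ≫ τ := by
    rw [eq_baseChange_map_comp_iff τ (α ≫ e) a ((baseChange k K).map (a ≫ b')).hom.hom.left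
      (by rw [baseChange_map_left, ← hb']; rfl)
      (by rw [Over.w, specMap_self, Category.comp_id])]
    have hα : (α ≫ e).hom.hom.left ≫ baseChangeFst K K V = α.hom.hom.left := by
      change (_ ≫ _) ≫ _ = _
      rw [Category.assoc, he, Category.comp_id]
    rw [hα]
    exact ⟨fun h ↦ by ext1; ext1; exact h, fun h ↦ by rw [h]; rfl⟩
  obtain ⟨a, ha, huniq⟩ := h.existsUnique k K hd hs C hC (α ≫ e)
  refine ⟨a ≫ b', (key a).mp ha, fun u hu ↦ ?_⟩
  have hbb : b ≫ b' = 𝟙 _ := by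
    ext1
    ext1
    refine Eq.trans (b := b.hom.hom.left ≫ b'.hom.hom.left) rfl ?_
    rw [hb', hb]
    rfl
  have := huniq (u ≫ b) ((key _).mpr (by rwa [Category.assoc, hbb, Category.comp_id]))
  rw [← this, Category.assoc, hbb, Category.comp_id]

/-- Any two traces are isomorphic. -/
lemma IsTrace.nonempty_iso {k K : Type} [Field k] [Field K] [Algebra k K] {V : GroupScheme K}
    (hV : IsAbelianVariety V) {B B' : GroupScheme k} {τ : (baseChange k K).obj B ⟶ V}
    {τ' : (baseChange k K).obj B' ⟶ V} (h : IsTrace k K V B τ) (h' : IsTrace k K V B' τ') :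
    Nonempty (B ≅ B') := by
  obtain ⟨u, hu, -⟩ := h'.existsUnique_hom hV h.isAbelianVariety τ
  obtain ⟨v, hv, -⟩ := h.existsUnique_hom hV h'.isAbelianVariety τ'
  refine ⟨⟨u, v, ?_, ?_⟩⟩
  · refine (h.existsUnique_hom hV h.isAbelianVariety τ).unique ?_ ?_
    · rw [Functor.map_comp, Category.assoc, ← hv, ← hu]
    · rw [CategoryTheory.Functor.map_id, Category.id_comp]
  · refine (h'.existsUnique_hom hV h'.isAbelianVariety τ').unique ?_ ?_
    · rw [Functor.map_comp, Category.assoc, ← hu, ← hv]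
    · rw [CategoryTheory.Functor.map_id, Category.id_comp]

end IsotrivialTrace

theorem mainTheorem8
    {𝒜 X : Over (Spec (CommRingCat.of ℂ))} (π : 𝒜 ⟶ X) (hπ : IsFlatProperFamily π)
    [AlgebraicGeometry.IsIntegral X.left] [GrpObj (genericFibre π)]
    (hA : IsAbelianVariety (Grp.mk (genericFibre π)))
    (M : 𝒜.left.Modules) (hM : IsAmple M) (hiso : IsIsotrivial π M)
    (G : Type) [Group G] (hG : IsHolonomyGroup π M G) (D : HolonomyDatum π M G) :
    (∃ (B : GroupScheme ℂ) (ι : B ⟶ D.A), IsMaximalFixedAbelianSubvariety D.act ι) ∧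
    ∀ (B : GroupScheme ℂ) (ι : B ⟶ D.A), IsMaximalFixedAbelianSubvariety D.act ι →
      (∃ τ : (baseChange ℂ X.left.functionField).obj B ⟶ Grp.mk (genericFibre π),
        IsTrace ℂ X.left.functionField (Grp.mk (genericFibre π)) B τ) ∧
      ∀ (T : GroupScheme ℂ)
        (τ : (baseChange ℂ X.left.functionField).obj T ⟶ Grp.mk (genericFibre π)),
        IsTrace ℂ X.left.functionField (Grp.mk (genericFibre π)) T τ → Nonempty (T ≅ B) := by
  have := hA.isProper
  obtain ⟨s⟩ := D.nonempty_splitting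
  refine ⟨exists_isMaximalFixedAbelianSubvariety D.act D.isAbelianVariety, fun B j hj ↦ ?_⟩
  obtain ⟨τ, hτ⟩ := s.isTrace D.isAbelianVariety hj
  exact ⟨⟨τ, hτ⟩, fun T τ' hτ' ↦ hτ'.nonempty_iso hA hτ⟩
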